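/- **Lemma (Upper bound on structure size).** Let $G$ be a finite simple graph, $M$ a matching of $G$, $\epsilon\in(0,1]$ with $\epsilon^{-1}$ a power of $2$, and let $h\in\{\frac12,\frac14,\frac18,\dots,\frac{\epsilon^2}{64}\}$ be a scale. Put $\ell_{\max}=3/\epsilon$, $\mathsf{limit}_h=\frac6h+1$ and $\tau_{\max}(h)=\frac{72}{h\epsilon}$. At every moment of every execution of the following phase on $(G,M,\epsilon,h)$, every structure $S_\alpha$ that is present has at most $\mathsf{limit}_h\cdot\ell_{\max}$ vertices, i.e. $|V(G_\alpha)|\le \mathsf{limit}_h\cdot \ell_{\max}$. *Terminology.* Every edge $\{u,v\}$ is represented by the arcs $(u,v)$ (tail $u$, head $v$) and $(v,u)$; it is matched if it is in $M$. A vertex is free if it has no incident matched edge. A blossom is a vertex set with an edge set: each $\{v\}$ with no edge is a (trivial) blossom, and if disjoint blossoms $A_0,\dots,A_{2m}$ ($m\ge1$) are connected in a cycle by edges $e_i\in A_i\times A_{i+1}$ (indices mod $2m+1$) with $e_1,e_3,\dots,e_{2m-1}$ matched, then $\bigcup_i A_i$ with the edges of all $A_i$ and all $e_i$ is a blossom.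 Each free vertex $\alpha$ that has not been removed has a structure $S_\alpha=(G_\alpha,\Omega_\alpha,w'_\alpha)$: a subgraph $G_\alpha$ (a set of vertices and arcs), a set $\Omega_\alpha$ of blossoms, and a working vertex $w'_\alpha$, which is $\emptyset$ or a vertex of the tree $T'_\alpha=G_\alpha/\Omega_\alpha$ obtained by contracting the maximal (root) blossoms. For $v\in G_\alpha$, $\Omega(v)$ is the root blossom containing $v$; for $v$ in no structure (unvisited), $\Omega(v)=\{v\}$. The root of $T'_\alpha$ is $\Omega(\alpha)$, and the arcs of $G_\alpha$ between different root blossoms go from parent to child. Vertices of $T'_\alpha$ at odd distance from the root are inner, all others outer. Every matched arc $a$ has a label $\ell(a)\in\mathbb N$. A structure is marked modified whenever one of the three operations below involves it. *Phase.* Initially no vertex is removed, no augmenting path is recorded, $\ell(a)=\ell_{\max}+1$ for each matched arc, and for each free $\alpha$: $V(G_\alpha)=\{\alpha\}$, $E(G_\alpha)=\emptyset$, $\Omega_\alpha=\{\{\alpha\}\}$, $w'_\alpha=\{\alpha\}$. Then $\tau_{\max}(h)$ pass-bundles are executed, each consisting of the following (in each pass the arcs arrive in an arbitrary order, each once). 1.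 Each $S_\alpha$ is marked on hold if it has at least $\mathsf{limit}_h$ vertices and not on hold otherwise, and is marked not modified. 2. *Extend-Active-Path.* For each arc $(u,v)$ of the stream: ignore it if $u$ or $v$ is removed, if $\Omega(u)=\Omega(v)$, if $(u,v)$ is matched, if $\Omega(u)$ is not a working vertex, or if the structure $S_\alpha$ containing $u$ is on hold or modified. Otherwise: if $\Omega(v)$ is an outer vertex of $S_\alpha$, Contract $(u,v)$; if it is an outer vertex of another structure, Augment with $(u,v)$; in the remaining case let $a=(v,t)$ be the matched arc with tail $v$ and let $d$ be $0$ if $\alpha\in\Omega(u)$ and otherwise the label of the matched arc that enters $\Omega(u)$ from outside; if $d+1<\ell(a)$, Overtake $a$ through $(u,v)$ with the new label $d+1$. 3. *Contract-and-Augment.* As long as there is an arc $(u,v)$ of $G$ with $u,v$ in the same structure $S_\alpha$, $\Omega(u)=w'_\alpha$, and $\Omega(v)\ne\Omega(u)$ outer, Contract one such arc (in any order). Then, for each arc $(u,v)$ of a pass, if $\Omega(u)$ and $\Omega(v)$ are outer vertices of different structures, Augment with $(u,v)$. 4. *Backtrack.* For each $S_\alpha$ that is neither on hold nor modified: if $w'_\alpha$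 is a non-root vertex, replace it by its grandparent in $T'_\alpha$; if it is the root, set $w'_\alpha=\emptyset$. *Augment with $(u,v)$*, $u\in S_\alpha$, $v\in S_\beta$: an augmenting path from $\alpha$ to $\beta$ consisting of $\{u,v\}$ and edges of $G_\alpha$ and $G_\beta$ is recorded, and $S_\alpha$, $S_\beta$ and all their vertices are removed until the end of the phase. *Contract $(u,v)$* in $S_\alpha$: let $B$ be the blossom formed by the cycle of $T'_\alpha\cup\{(\Omega(u),\Omega(v))\}$. Add $(u,v)$ to $G_\alpha$ and $B$ to $\Omega_\alpha$, set $w'_\alpha=B$, and set the label of each matched arc with both ends in $B$ to $0$. *Overtake $a=(v,t)$ through $(u,v)$ with new label $k$*, $u\in S_\alpha$: set $\ell(a)=k$. (i) If $v$ is unvisited, add the vertices $v,t$ and the arcs $(u,v),(v,t)$ to $G_\alpha$, the trivial blossoms $\{v\},\{t\}$ to $\Omega_\alpha$, and set $w'_\alpha=\{t\}$. Otherwise let $v\in S_\beta$ and let $(p,v)$ be the arc of $G_\beta$ from the parent of $\Omega(v)$. (ii) If $\beta=\alpha$, replace $(p,v)$ by $(u,v)$ in $G_\alpha$ and set $w'_\alpha=\Omega(t)$.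 (iii) If $\beta\neq\alpha$, remove $(p,v)$ from $G_\beta$, add $(u,v)$ to $G_\alpha$, and move from $S_\beta$ to $S_\alpha$ all vertices $x$ with $\Omega(x)$ in the subtree of $\Omega(v)$, all arcs between moved vertices, and all blossoms consisting of moved vertices; if $w'_\beta$ was in the subtree of $\Omega(t)$, set $w'_\alpha$ to the old $w'_\beta$ and then $w'_\beta=\Omega(p)$, and otherwise set $w'_\alpha=\Omega(t)$. -/

import Mathlib

namespace AlgPhase

/-- A blossom: a vertex set together with an edge set on it. -/
@[ext] structure Blossom (V : Type*) where
  verts : Set V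
  edges : Set (Sym2 V)

/-- The trivial blossom of a vertex. -/
def Blossom.trivial {V : Type*} (v : V) : Blossom V := ⟨{v}, ∅⟩

/-- `B` is the blossom obtained from the vertex-disjoint blossoms `A 0, …, A (2 * m)`, connected in
a cycle by the edges `e 0, …, e (2 * m)`, where `e i` joins `A i` to `A (i + 1)` (indices modulo
`2 * m + 1`) and `e 1, e 3, …, e (2 * m - 1)` are matched. -/
structure FormsBlossom {V : Type*} {G : SimpleGraph V} (M : G.Subgraph) (m : ℕ)
    (A : Fin (2 * m + 1) → Blossom V) (e : Fin (2 * m + 1) → V × V) (B : Blossom V) : Prop where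
  pos : 1 ≤ m
  disjoint : ∀ i j, i ≠ j → Disjoint (A i).verts (A j).verts
  edge_mem : ∀ i, (e i).1 ∈ (A i).verts ∧ (e i).2 ∈ (A (i + 1)).verts
  matched : ∀ i : Fin (2 * m + 1), Odd (i : ℕ) → M.Adj (e i).1 (e i).2
  verts_eq : B.verts = ⋃ i, (A i).verts
  edges_eq : B.edges = (⋃ i, (A i).edges) ∪ Set.range (fun i => s((e i).1, (e i).2))

/-- The data `(G_α, Ω_α, w'_α)` of the structure of a free vertex `α`: `G_α` is given by its
vertices and its arcs, `Ω_α` is a set of blossoms, and `w'_α` is the working vertex (`none` for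
`∅`).  A vertex of the contracted graph `T'_α = G_α / Ω_α` is a root blossom of `Ω_α`, which is
represented by its vertex set. -/
structure Struct (V : Type*) where
  verts : Set V
  arcs : Set (V × V)
  blossoms : Set (Blossom V)
  work : Option (Set V)

namespace Struct

variable {V : Type*}

/-- The vertex `Ω_α(v)` of `T'_α`: the vertex set of the root blossom containing `v`.  Since
`Ω_α` is laminar, this is the union of all the blossoms of `Ω_α` containing `v`. -/
def root (S : Struct V) (v : V) : Set V := {x | ∃ B ∈ S.blossoms, v ∈ B.verts ∧ x ∈ B.verts}

/-- A blossom of `Ω_α` that is not contained in any other blossom of `Ω_α`. -/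
def IsRootBlossom (S : Struct V) (B : Blossom V) : Prop :=
  B ∈ S.blossoms ∧ ∀ C ∈ S.blossoms, B.verts ⊆ C.verts → C = B

/-- `A` is the parent of `B` in `T'_α`: the non-blossom arcs of `G_α` are directed from the parent
to the child. -/
def TreeArc (S : Struct V) (A B : Set V) : Prop :=
  A ≠ B ∧ ∃ x y, (x, y) ∈ S.arcs ∧ S.root x = A ∧ S.root y = B

/-- `B` is in the subtree of `T'_α` rooted at `A`. -/
def InSubtree (S : Struct V) (A B : Set V) : Prop := Relation.ReflTransGen S.TreeArc A B

/-- `T'_α` has a path of length `n` from its root `Ω_α(α)` to the given vertex. -/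
inductive AtDepth (S : Struct V) (α : V) : ℕ → Set V → Prop
  | root : AtDepth S α 0 (S.root α)
  | child {n : ℕ} {A B : Set V} : AtDepth S α n A → S.TreeArc A B → AtDepth S α (n + 1) B

/-- Inner vertices of `T'_α`. -/
def IsInner (S : Struct V) (α : V) (A : Set V) : Prop :=
  A ≠ S.root α ∧ ∃ n, Odd n ∧ S.AtDepth α n A

/-- Outer vertices of `T'_α`: all the vertices that are not inner. -/
def IsOuter (S : Struct V) (α : V) (A : Set V) : Prop :=
  (∃ v ∈ S.verts, S.root v = A) ∧ ¬ S.IsInner α A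

/-- The structure of a free vertex at the beginning of a phase. -/
def single (α : V) : Struct V := ⟨{α}, ∅, {Blossom.trivial α}, some {α}⟩

end Struct

/-- The maximum label `ℓ_max = 3 / ε` (an integer when `ε⁻¹` is a power of two). -/
noncomputable def ellMax (ε : ℝ) : ℕ := ⌊3 / ε⌋₊

/-- The size `limit_h` from which on a structure is put on hold. -/
noncomputable def limit (h : ℝ) : ℝ := 6 / h + 1

/-- The number `τ_max(h) = 72 / (h ε)` of pass-bundles of a phase (an integer when `ε⁻¹` and `h⁻¹`
are powers of two). -/
noncomputable def tauMax (ε h : ℝ) : ℕ := ⌊72 / (h * ε)⌋₊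

/-- The memory during a phase: the recorded augmenting paths (lists of vertices), the removed
vertices, the labels of the arcs (only those of matched arcs matter), the structures (`none` for a
vertex that is not free and for a structure that has been removed), and the two kinds of marks on
the structures. -/
structure State (V : Type*) where
  paths : Set (List V)
  removed : Set V
  label : V × V → ℕ
  str : V → Option (Struct V)
  onHold : Set V
  modified : Set V

section Operations

variable {V : Type*} {G : SimpleGraph V} (M : G.Subgraph)

/-- A vertex without incident matched edge. -/
def IsFree (v : V) : Prop := ∀ w, ¬ M.Adj v w

/-- An augmenting path: a simple path between two distinct free vertices whose edges are
alternately unmatched and matched. -/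
def IsAugmenting {α β : V} (p : G.Walk α β) : Prop :=
  α ≠ β ∧ IsFree M α ∧ IsFree M β ∧ p.IsPath ∧ p.toSubgraph.spanningCoe.IsAlternating M.spanningCoe

/-- A vertex that is in no structure. -/
def State.Unvisited (s : State V) (v : V) : Prop := ∀ β T, s.str β = some T → v ∉ T.verts

/-- `Ω(v)` is an outer vertex of some structure. -/
def State.OuterAt (s : State V) (v : V) : Prop :=
  ∃ β T, s.str β = some T ∧ v ∈ T.verts ∧ T.IsOuter β (T.root v)

open Classical in
/-- The operation Augment on the arc `(u, v)` joining the structures of `α` and `β`. The recorded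
path consists of `(u, v)` and of edges of the two structures. -/
def Augment (s : State V) (α β u v : V) (s' : State V) : Prop :=
  ∃ S T, s.str α = some S ∧ s.str β = some T ∧ ∃ p : G.Walk α β, IsAugmenting M p ∧
    s(u, v) ∈ p.edges ∧
    (∀ x y, s(x, y) ∈ p.edges → s(x, y) ≠ s(u, v) →
      (x, y) ∈ S.arcs ∪ T.arcs ∨ (y, x) ∈ S.arcs ∪ T.arcs) ∧
    s' = { s with
      paths := insert p.support s.paths
      removed := s.removed ∪ (S.verts ∪ T.verts)
      str := Function.update (Function.update s.str α none) β none
      modified := s.modified ∪ {α, β} }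

open Classical in
/-- The operation Contract on the arc `(u, v)` inside the structure of `α`: the blossom `B`
contained in `T'_α ∪ {(Ω(u), Ω(v))}` is contracted. -/
def Contract (s : State V) (α u v : V) (s' : State V) : Prop :=
  ∃ S, s.str α = some S ∧ ∃ m A e B, FormsBlossom M m A e B ∧
    (∀ i, S.IsRootBlossom (A i)) ∧
    (∀ i, e i ∈ insert (u, v) S.arcs ∨ (e i).swap ∈ insert (u, v) S.arcs) ∧
    s' = { s with
      label := fun a =>
        if M.Adj a.1 a.2 ∧ a.1 ∈ B.verts ∧ a.2 ∈ B.verts then 0 else s.label a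
      str := Function.update s.str α (some
        { S with
          arcs := insert (u, v) S.arcs
          blossoms := insert B S.blossoms
          work := some B.verts })
      modified := insert α s.modified }

/-- The vertices of `G` in the subtree of `T'_β` rooted at `Ω(v)`. -/
def Struct.below (T : Struct V) (v : V) : Set V :=
  {x ∈ T.verts | T.InSubtree (T.root v) (T.root x)}

/-- The working vertex is in the subtree rooted at `Ω(t)`. -/
def Struct.WorkBelow (T : Struct V) (t : V) : Prop :=
  ∃ W, T.work = some W ∧ T.InSubtree (T.root t) W

/-- The arcs both of whose ends are in `X`. -/
def Struct.arcsIn (T : Struct V) (X : Set V) : Set (V × V) := {a ∈ T.arcs | a.1 ∈ X ∧ a.2 ∈ X}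

/-- The blossoms that consist of vertices of `X`. -/
def Struct.blossomsIn (T : Struct V) (X : Set V) : Set (Blossom V) :=
  {B ∈ T.blossoms | B.verts ⊆ X}

open Classical in
/-- The operation Overtake: the structure of `α` overtakes the matched arc `(v, t)` through the
unmatched arc `(u, v)` and reduces its label to `k`. -/
inductive Overtake (s : State V) (α u v t : V) (k : ℕ) : State V → Prop
  /-- The matched arc is in no structure. -/
  | unvisited {S : Struct V} : s.str α = some S → s.Unvisited v →
      Overtake s α u v t k { s with
        label := Function.update s.label (v, t) k
        str := Function.update s.str α (some
          { verts := S.verts ∪ {v, t}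
            arcs := S.arcs ∪ {(u, v), (v, t)}
            blossoms := S.blossoms ∪ {Blossom.trivial v, Blossom.trivial t}
            work := some {t} })
        modified := insert α s.modified }
  /-- The matched arc is in the same structure. -/
  | same {S : Struct V} {p : V} : s.str α = some S → v ∈ S.verts →
      (p, v) ∈ S.arcs → S.root p ≠ S.root v →
      Overtake s α u v t k { s with
        label := Function.update s.label (v, t) k
        str := Function.update s.str α (some
          { S with
            arcs := (S.arcs \ {(p, v)}) ∪ {(u, v)}
            work := some (S.root t) })
        modified := insert α s.modified }
  /-- The matched arc is in the structure of another vertex `β`. -/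
  | other {S T : Struct V} {β p : V} : s.str α = some S → α ≠ β → s.str β = some T →
      v ∈ T.verts → (p, v) ∈ T.arcs → T.root p ≠ T.root v →
      Overtake s α u v t k { s with
        label := Function.update s.label (v, t) k
        str := Function.update (Function.update s.str α (some
          { verts := S.verts ∪ T.below v
            arcs := S.arcs ∪ {(u, v)} ∪ T.arcsIn (T.below v)
            blossoms := S.blossoms ∪ T.blossomsIn (T.below v)
            work := if T.WorkBelow t then T.work else some (T.root t) })) β (some
          { verts := T.verts \ T.below v
            arcs := (T.arcs \ {(p, v)}) \ T.arcsIn (T.below v)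
            blossoms := T.blossoms \ T.blossomsIn (T.below v)
            work := if T.WorkBelow t then some (T.root p) else T.work })
        modified := s.modified ∪ {α, β} }

/-- The arc `(u, v)` is not ignored by Extend-Active-Path: it is an unmatched non-blossom arc,
no end of which is removed, and `Ω(u)` is the working vertex of the structure of `α`, which is
neither on hold nor modified. -/
structure Eligible (s : State V) (α : V) (S : Struct V) (u v : V) : Prop where
  str : s.str α = some S
  removed : u ∉ s.removed ∧ v ∉ s.removed
  mem : u ∈ S.verts
  work : S.work = some (S.root u)
  nonblossom : S.root u ≠ S.root v
  unmatched : ¬ M.Adj u v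
  not_modified : α ∉ s.modified
  not_onHold : α ∉ s.onHold

/-- `distance(u)` for a vertex `u` of the structure of `α`: it is `0` if `Ω(u)` is free, and
otherwise it is the label of the matched non-blossom arc with head in `Ω(u)`. -/
def IsDistance (s : State V) (α : V) (S : Struct V) (u : V) (d : ℕ) : Prop :=
  (α ∈ S.root u ∧ d = 0) ∨
    (α ∉ S.root u ∧ ∃ x y, M.Adj x y ∧ x ∉ S.root u ∧ y ∈ S.root u ∧ d = s.label (x, y))

/-- The test made before Overtake is invoked on `(u, v)`, the matched arc `(v, t)` and
`distance(u) + 1`, where `d = distance(u)`. -/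
def OvertakeTest (s : State V) (α : V) (S : Struct V) (u v t : V) (d : ℕ) : Prop :=
  Eligible M s α S u v ∧ ¬ s.OuterAt v ∧ M.Adj v t ∧ IsDistance M s α S u d ∧
    d + 1 < s.label (v, t)

/-- One iteration of the loop of Extend-Active-Path, for the arc `(u, v)`. -/
inductive ExtendArc (s : State V) (u v : V) : State V → Prop
  | contract {α : V} {S : Struct V} {s' : State V} : Eligible M s α S u v →
      v ∈ S.verts → S.IsOuter α (S.root v) → Contract M s α u v s' → ExtendArc s u v s'
  | augment {α β : V} {S T : Struct V} {s' : State V} : Eligible M s α S u v →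
      α ≠ β → s.str β = some T → v ∈ T.verts → T.IsOuter β (T.root v) →
      Augment M s α β u v s' → ExtendArc s u v s'
  | overtake {α t : V} {S : Struct V} {d : ℕ} {s' : State V} : OvertakeTest M s α S u v t d →
      Overtake s α u v t (d + 1) s' → ExtendArc s u v s'
  | skip : (¬ ∃ α S, Eligible M s α S u v ∧ s.OuterAt v) →
      (¬ ∃ α S t d, OvertakeTest M s α S u v t d) → ExtendArc s u v s

variable (G) in
/-- The arc `(u, v)` of `G` joins two distinct outer vertices of the structure of `α`, the first
of which is the working vertex. -/
def ContractTest (s : State V) (α u v : V) : Prop :=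
  G.Adj u v ∧ ∃ S, s.str α = some S ∧ u ∈ S.verts ∧ v ∈ S.verts ∧
    S.work = some (S.root u) ∧ S.root v ≠ S.root u ∧ S.IsOuter α (S.root v)

/-- `Ω(u)` and `Ω(v)` are outer vertices of the structures of `α` and `β`, which are different. -/
def AugmentTest (s : State V) (α β u v : V) : Prop :=
  α ≠ β ∧ ∃ S T, s.str α = some S ∧ s.str β = some T ∧ u ∈ S.verts ∧ v ∈ T.verts ∧
    S.IsOuter α (S.root u) ∧ T.IsOuter β (T.root v)

/-- One iteration, for the arc `(u, v)`, of the second step of Contract-and-Augment. -/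
inductive AugmentArc (s : State V) (u v : V) : State V → Prop
  | augment {α β : V} {s' : State V} : AugmentTest s α β u v → Augment M s α β u v s' →
      AugmentArc s u v s'
  | skip : (¬ ∃ α β, AugmentTest s α β u v) → AugmentArc s u v s

/-- The backtracking of one structure: the working vertex moves to its grandparent, or becomes `∅`
if it is the root. -/
inductive BacktrackStr (α : V) (S : Struct V) : Struct V → Prop
  | inactive : S.work = none → BacktrackStr α S S
  | root : S.work = some (S.root α) → BacktrackStr α S { S with work := none }
  | nonroot {A B C : Set V} : S.work = some C → C ≠ S.root α → S.TreeArc B C → S.TreeArc A B →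
      BacktrackStr α S { S with work := some A }

/-- Backtrack-Stuck-Structures. -/
def Backtrack (s s' : State V) : Prop :=
  ∃ str' : V → Option (Struct V), s' = { s with str := str' } ∧
    ∀ α, (s.str α = none → str' α = none) ∧
      ∀ S, s.str α = some S →
        (α ∈ s.onHold ∨ α ∈ s.modified → str' α = some S) ∧
        (α ∉ s.onHold ∧ α ∉ s.modified → ∃ S', BacktrackStr α S S' ∧ str' α = some S')

/-- The marking of the structures at the beginning of a pass-bundle. -/
def mark (h : ℝ) (s : State V) : State V :=
  { s with
    onHold := {α | ∃ S, s.str α = some S ∧ limit h ≤ (S.verts.ncard : ℝ)}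
    modified := ∅ }

open Classical in
/-- The state at the beginning of a phase. -/
noncomputable def initState (ε : ℝ) : State V where
  paths := ∅
  removed := ∅
  label := fun _ => ellMax ε + 1
  str := fun α => if IsFree M α then some (Struct.single α) else none
  onHold := ∅
  modified := ∅

variable (G) in
/-- A pass over the stream: every arc of `G` once, in an arbitrary order. -/
def IsStream (L : List (V × V)) : Prop := L.Nodup ∧ ∀ u v, (u, v) ∈ L ↔ G.Adj u v

end Operations

/-- The point reached in the execution of a phase; the natural number is the number of completed
pass-bundles, the list is the part of the stream that is still to be read in the current pass. -/
inductive Point (V : Type*) where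
  | bundle : ℕ → Point V
  | extend : ℕ → List (V × V) → Point V
  | contract : ℕ → Point V
  | augment : ℕ → List (V × V) → Point V

/-- One step of the execution of a phase with matching `M`. -/
inductive Step {V : Type*} {G : SimpleGraph V} (M : G.Subgraph) (ε h : ℝ) :
    Point V × State V → Point V × State V → Prop
  /-- A new pass-bundle begins: the structures are marked and Extend-Active-Path is started. -/
  | start {τ : ℕ} {L : List (V × V)} {s : State V} : τ < tauMax ε h → IsStream G L →
      Step M ε h (.bundle τ, s) (.extend τ L, mark h s)
  | extend {τ : ℕ} {u v : V} {L : List (V × V)} {s s' : State V} : ExtendArc M s u v s' →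
      Step M ε h (.extend τ ((u, v) :: L), s) (.extend τ L, s')
  | extended {τ : ℕ} {s : State V} : Step M ε h (.extend τ [], s) (.contract τ, s)
  /-- The first step of Contract-and-Augment, repeated as long as possible. -/
  | contract {τ : ℕ} {α u v : V} {s s' : State V} : ContractTest G s α u v →
      Contract M s α u v s' → Step M ε h (.contract τ, s) (.contract τ, s')
  | contracted {τ : ℕ} {L : List (V × V)} {s : State V} :
      (¬ ∃ α u v, ContractTest G s α u v) → IsStream G L →
      Step M ε h (.contract τ, s) (.augment τ L, s)
  | augment {τ : ℕ} {u v : V} {L : List (V × V)} {s s' : State V} : AugmentArc M s u v s' →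
      Step M ε h (.augment τ ((u, v) :: L), s) (.augment τ L, s')
  | backtrack {τ : ℕ} {s s' : State V} : Backtrack s s' →
      Step M ε h (.augment τ [], s) (.bundle (τ + 1), s')

/-- The state `s` occurs, at the point `c`, in some execution of a phase of scale `h` that starts
with the matching `M`. -/
def Occurs {V : Type*} {G : SimpleGraph V} (M : G.Subgraph) (ε h : ℝ) (c : Point V) (s : State V) :
    Prop :=
  Relation.ReflTransGen (Step M ε h) (.bundle 0, initState M ε) (c, s)

/-- The scales are `1/2, 1/4, 1/8, …, ε² / 64`. -/
def IsScale (ε h : ℝ) : Prop := ∃ i : ℕ, 1 ≤ i ∧ h = (1 / 2) ^ i ∧ ε ^ 2 / 64 ≤ h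

end AlgPhase

/-! Every structure is an alternating tree of blossoms. Let the rank of an inner vertex be the label
of its matched arc, pass this rank on to the outer blossom entered by that arc, and give the root
rank `0`. The rank of an outer blossom is then the distance computed by Extend-Active-Path, and
ranks never decrease down the tree and increase strictly from outer to inner. Write `K` for `limit
h` and `L` for `ellMax ε`. The invariant (`State.Inv`) says that the part below an inner vertex `x`
has at most `K * (L + 1 - r x)` vertices, and that a whole structure has at most `K * L`.

Only Overtake enlarges a structure, and the structure `S` that does so is neither on hold nor
modified, hence has fewer than `K` vertices. If it takes the part below `v` from another structure,
the label test gives `r v ≥ r u + 2`, so this part has at most `K * (L - 1 - r u)` vertices and the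
union at most `K * (L - r u)`. This is at most `K * L`, and it is good enough for every inner
ancestor `x` of `u`, since `r x ≤ r u`. Inside the moved part ranks only drop, which weakens the
bounds there (`overtake_other`). An unvisited arc contributes two vertices, which fit because `r u +
1 ≤ L` and `K, L ≥ 2`; overtaking within one structure does not change its size.

Contract adds no vertices. The contracted cycle is a connected piece of the tree with an outer top
(`exists_isPetal`), so a subtree hanging from outside it contains all of it or none, and no subtree
grows. The marks make the size bound `K` available whenever it is needed: a structure that has grown
is modified and cannot overtake again in the same pass-bundle.

The inner set `I` and the ranks `r` are auxiliary data that the algorithm does not store; each step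
provides new ones. Tree surgery is split into cutting (`AltTree.pruned`, `AltTree.piece`),
relabelling (`AltTree.relabel`) and attaching (`AltTree.graft`). -/

namespace AlgPhase

/-! ### Alternating trees of blossoms -/

section Trees

variable {V : Type*} {G : SimpleGraph V}

/-- `S` is an alternating tree of blossoms with root `S.root ρ`, with set `I` of inner vertices and
ranks `r`: the rank of an inner vertex is the label of its matched arc, and it is passed on to the
outer blossom entered by that arc. -/
structure AltTree (M : G.Subgraph) (l : V × V → ℕ) (I : Set V) (r : V → ℕ) (ρ : V)
    (S : Struct V) : Prop where
  mem : ρ ∈ S.verts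
  blossom_sub : ∀ B ∈ S.blossoms, B.verts ⊆ S.verts
  exists_blossom : ∀ x ∈ S.verts, ∃ B ∈ S.blossoms, x ∈ B.verts ∧ B.verts = S.root x
  root_eq : ∀ x y, y ∈ S.root x → S.root y = S.root x
  arcs_sub : ∀ x y, (x, y) ∈ S.arcs → x ∈ S.verts ∧ y ∈ S.verts
  inner_root : ∀ x ∈ S.verts, x ∈ I → S.root x = {x}
  rank_root : ∀ x y, y ∈ S.root x → r y = r x
  inner_child : ∀ x ∈ S.verts, x ∈ I → ∃ t, t ∉ I ∧ M.Adj x t ∧ (x, t) ∈ S.arcs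
  label_eq : ∀ x ∈ S.verts, x ∈ I → ∀ t, M.Adj x t → l (x, t) = r x
  cross : ∀ x y, (x, y) ∈ S.arcs → S.root x ≠ S.root y →
    (x ∉ I ∧ y ∈ I ∧ r x < r y) ∨ (x ∈ I ∧ y ∉ I ∧ M.Adj x y ∧ r x = r y)
  outer_mate : ∀ y ∈ S.verts, y ∉ I → ∀ z, M.Adj z y → z ∈ S.root y ∨ (z ∈ I ∧ z ∈ S.verts)
  unique : ∀ x y x' y', (x, y) ∈ S.arcs → (x', y') ∈ S.arcs → S.root x ≠ S.root y →
    S.root x' ≠ S.root y' → S.root y = S.root y' → x = x' ∧ y = y'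
  no_parent : ∀ x y, (x, y) ∈ S.arcs → S.root x ≠ S.root y → S.root y ≠ S.root ρ
  parent : ∀ x ∈ S.verts, S.root x ≠ S.root ρ →
    ∃ z y, (z, y) ∈ S.arcs ∧ S.root y = S.root x ∧ S.root z ≠ S.root x

open Classical in
/-- A potential that increases strictly along the arcs of an alternating tree. -/
noncomputable def height (I : Set V) (r : V → ℕ) (x : V) : ℕ := 2 * r x + if x ∈ I then 0 else 1

namespace AltTree

variable {M : G.Subgraph} {l : V × V → ℕ} {I : Set V} {r : V → ℕ} {ρ : V} {S : Struct V}

theorem mem_root_self (hS : AltTree M l I r ρ S) {x : V} (hx : x ∈ S.verts) : x ∈ S.root x := by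
  obtain ⟨B, hB, hxB, -⟩ := hS.exists_blossom x hx
  exact ⟨B, hB, hxB, hxB⟩

theorem root_subset (hS : AltTree M l I r ρ S) (x : V) : S.root x ⊆ S.verts := by
  rintro y ⟨B, hB, -, hyB⟩
  exact hS.blossom_sub B hB hyB

theorem mem_root_of_eq (hS : AltTree M l I r ρ S) {x y : V} (hy : y ∈ S.verts)
    (h : S.root y = S.root x) : y ∈ S.root x := h ▸ hS.mem_root_self hy

theorem rank_congr (hS : AltTree M l I r ρ S) {x y : V} (hy : y ∈ S.verts)
    (h : S.root y = S.root x) : r y = r x := hS.rank_root x y (hS.mem_root_of_eq hy h)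

theorem eq_of_inner (hS : AltTree M l I r ρ S) {x y : V} (hx : x ∈ S.verts) (hy : y ∈ S.verts)
    (hxI : x ∈ I) (h : S.root y = S.root x) : y = x := by
  have := hS.mem_root_of_eq hy h
  rwa [hS.inner_root x hx hxI] at this

theorem inner_congr (hS : AltTree M l I r ρ S) {x y : V} (hx : x ∈ S.verts) (hy : y ∈ S.verts)
    (h : S.root y = S.root x) : y ∈ I ↔ x ∈ I :=
  ⟨fun hyI => hS.eq_of_inner hy hx hyI h.symm ▸ hyI,
    fun hxI => hS.eq_of_inner hx hy hxI h ▸ hxI⟩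

theorem root_ne_of_inner_outer (hS : AltTree M l I r ρ S) {x y : V} (hx : x ∈ S.verts)
    (hy : y ∈ S.verts) (hxI : x ∈ I) (hyI : y ∉ I) : S.root x ≠ S.root y :=
  fun h => hyI ((hS.inner_congr hy hx h).1 hxI)

theorem height_congr (hS : AltTree M l I r ρ S) {x y : V} (hx : x ∈ S.verts) (hy : y ∈ S.verts)
    (h : S.root y = S.root x) : height I r y = height I r x := by
  have := hS.inner_congr hx hy h
  unfold height
  rw [hS.rank_congr hy h]
  by_cases hxI : x ∈ I <;> simp [hxI, this]

theorem height_lt (hS : AltTree M l I r ρ S) {x y : V} (h : (x, y) ∈ S.arcs)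
    (hne : S.root x ≠ S.root y) : height I r x < height I r y := by
  rcases hS.cross x y h hne with ⟨h1, h2, h3⟩ | ⟨h1, h2, -, h3⟩ <;> simp [height, h1, h2] <;> omega

theorem child_eq (hS : AltTree M l I r ρ S) (hM : M.IsMatching) {x t : V} (hx : x ∈ S.verts)
    (hxI : x ∈ I) (h : M.Adj x t) : t ∉ I ∧ (x, t) ∈ S.arcs ∧ S.root x ≠ S.root t := by
  obtain ⟨t', h1, h2, h3⟩ := hS.inner_child x hx hxI
  obtain rfl := hM.eq_of_adj_left h h2
  exact ⟨h1, h3, hS.root_ne_of_inner_outer hx (hS.arcs_sub _ _ h3).2 hxI h1⟩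

/-- A matched edge never has exactly one end in a tree. Hence the mate of an unvisited vertex is
unvisited as well. -/
theorem mate_mem (hS : AltTree M l I r ρ S) (hM : M.IsMatching) {x z : V} (hx : x ∈ S.verts)
    (h : M.Adj x z) : z ∈ S.verts := by
  by_cases hxI : x ∈ I
  · exact (hS.arcs_sub _ _ (hS.child_eq hM hx hxI h).2.1).2
  · rcases hS.outer_mate x hx hxI z h.symm with h | h
    · exact hS.root_subset _ h
    · exact h.2

theorem below_root (hS : AltTree M l I r ρ S) {v x y : V} (hx : x ∈ S.below v)
    (hy : y ∈ S.root x) : y ∈ S.below v :=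
  ⟨hS.root_subset _ hy, by rw [hS.root_eq x y hy]; exact hx.2⟩

theorem below_of_root_eq (hS : AltTree M l I r ρ S) {v x y : V} (hx : x ∈ S.below v)
    (hy : y ∈ S.verts) (h : S.root y = S.root x) : y ∈ S.below v :=
  hS.below_root hx (hS.mem_root_of_eq hy h)

theorem below_arc (hS : AltTree M l I r ρ S) {v x y : V} (hx : x ∈ S.below v)
    (hxy : (x, y) ∈ S.arcs) : y ∈ S.below v := by
  refine ⟨(hS.arcs_sub _ _ hxy).2, ?_⟩
  by_cases h : S.root x = S.root y
  · rw [← h]; exact hx.2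
  · exact Relation.ReflTransGen.tail hx.2 ⟨h, x, y, hxy, rfl, rfl⟩

theorem mem_below_self {v : V} (hv : v ∈ S.verts) : v ∈ S.below v :=
  ⟨hv, Relation.ReflTransGen.refl⟩

/-- A set that is closed under root blossoms and arcs contains what is below its elements. -/
theorem below_subset (hS : AltTree M l I r ρ S) {v : V} {D : Set V} (hv : v ∈ D)
    (hroot : ∀ x ∈ D, S.root x ⊆ D) (harc : ∀ x y, x ∈ D → (x, y) ∈ S.arcs → y ∈ D) :
    S.below v ⊆ D := by
  rintro x ⟨hx, hsub⟩
  have key : ∀ A, S.InSubtree (S.root v) A → A ⊆ D := by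
    intro A hA
    induction hA with
    | refl => exact hroot v hv
    | tail _ h ih =>
      obtain ⟨-, x, y, hxy, rfl, rfl⟩ := h
      exact hroot y (harc x y (ih (hS.mem_root_self (hS.arcs_sub _ _ hxy).1)) hxy)
  exact key _ hsub (hS.mem_root_self hx)

/-- The path from `S.root v` to `S.root x` ends with an arc entering `S.root x`, and there is only
one such arc. -/
theorem parent_mem_below (hS : AltTree M l I r ρ S) {v x y z : V} (hx : x ∈ S.below v)
    (hne : S.root x ≠ S.root v) (hzy : (z, y) ∈ S.arcs) (hy : S.root y = S.root x)
    (hz : S.root z ≠ S.root y) : z ∈ S.below v := by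
  refine ⟨(hS.arcs_sub _ _ hzy).1, ?_⟩
  rcases Relation.ReflTransGen.cases_tail hx.2 with h | ⟨A, hA, hne', x', y', hxy', rfl, hy'⟩
  · exact absurd h hne
  · have := hS.unique z y x' y' hzy hxy' hz (hy' ▸ hne') (by rw [hy, hy'])
    rw [this.1]
    exact hA

theorem height_le_of_mem_below (hS : AltTree M l I r ρ S) {v x : V} (hv : v ∈ S.verts)
    (hx : x ∈ S.below v) : height I r v ≤ height I r x := by
  have : S.below v ⊆ {x ∈ S.verts | height I r v ≤ height I r x} := by
    refine hS.below_subset ⟨hv, le_rfl⟩ ?_ ?_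
    · rintro x ⟨hx, h⟩ y hy
      exact ⟨hS.root_subset _ hy,
        h.trans (hS.height_congr hx (hS.root_subset _ hy) (hS.root_eq _ _ hy)).ge⟩
    · rintro x y ⟨hx, h⟩ hxy
      refine ⟨(hS.arcs_sub _ _ hxy).2, h.trans ?_⟩
      by_cases hc : S.root x = S.root y
      · exact (hS.height_congr hx (hS.arcs_sub _ _ hxy).2 hc.symm).ge
      · exact (hS.height_lt hxy hc).le
  exact (this hx).2

/-- An inner vertex has height exactly `2 * r v`, so the monotonicity of heights passes to ranks. -/
theorem rank_le_of_mem_below (hS : AltTree M l I r ρ S) {v x : V} (hv : v ∈ S.verts)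
    (hvI : v ∈ I) (hx : x ∈ S.below v) : r v ≤ r x := by
  have := hS.height_le_of_mem_below hv hx
  simp only [height, hvI, if_true] at this
  split_ifs at this <;> omega

theorem root_notMem_below (hS : AltTree M l I r ρ S) {v : V} (hne : S.root v ≠ S.root ρ) :
    ρ ∉ S.below v := by
  rintro ⟨-, h⟩
  rcases Relation.ReflTransGen.cases_tail h with h | ⟨A, -, hA, x, y, hxy, rfl, hy⟩
  · exact hne h.symm
  · exact hS.no_parent x y hxy (hy ▸ hA) hy

theorem parent_notMem_below (hS : AltTree M l I r ρ S) {p v : V} (h : (p, v) ∈ S.arcs)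
    (hne : S.root p ≠ S.root v) : p ∉ S.below v := fun hp =>
  absurd (hS.height_le_of_mem_below (hS.arcs_sub _ _ h).2 hp) (hS.height_lt h hne).not_ge

/-- Connects the parity of the depth, used by the algorithm, with the set `I`: arcs between root
blossoms alternate between the two kinds, and every root blossom is reached from the root. -/
theorem isOuter_iff (hS : AltTree M l I r ρ S) (hρ : ρ ∉ I) {x : V} (hx : x ∈ S.verts) :
    S.IsOuter ρ (S.root x) ↔ x ∉ I := by
  have parity : ∀ n A, S.AtDepth ρ n A → ∃ x ∈ S.verts, S.root x = A ∧ (x ∈ I ↔ Odd n) := by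
    intro n A h
    induction h with
    | root => exact ⟨ρ, hS.mem, rfl, by simp [hρ]⟩
    | child _ h ih =>
      obtain ⟨hne, y, z, hyz, rfl, rfl⟩ := h
      obtain ⟨x, hx, hxy, hxI⟩ := ih
      obtain ⟨hy, hz⟩ := hS.arcs_sub _ _ hyz
      refine ⟨z, hz, rfl, ?_⟩
      rw [hS.inner_congr hy hx hxy] at hxI
      rw [Nat.odd_add_one, ← hxI]
      rcases hS.cross y z hyz hne with h | h <;> simp [h.1, h.2.1]
  -- Going to the parent lowers the height, so the climb ends at the root.
  have reach : ∀ k, ∀ x ∈ S.verts, height I r x = k → ∃ n, S.AtDepth ρ n (S.root x) := by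
    intro k
    induction k using Nat.strong_induction_on with
    | _ k ih =>
      intro x hx hk
      by_cases h : S.root x = S.root ρ
      · exact ⟨0, h ▸ Struct.AtDepth.root⟩
      · obtain ⟨z, y, hzy, hy, hz⟩ := hS.parent x hx h
        obtain ⟨hzv, hyv⟩ := hS.arcs_sub _ _ hzy
        obtain ⟨n, hn⟩ := ih (height I r z) (by
          rw [← hk, ← hS.height_congr hx hyv hy]
          exact hS.height_lt hzy (hy ▸ hz)) z hzv rfl
        exact ⟨n + 1, hn.child ⟨hz, z, y, hzy, rfl, hy⟩⟩
  constructor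
  · rintro ⟨-, h⟩ hxI
    refine h ⟨fun hc => hρ ((hS.inner_congr hx hS.mem hc.symm).2 hxI), ?_⟩
    obtain ⟨n, hn⟩ := reach _ x hx rfl
    obtain ⟨y, hy, hyx, hyI⟩ := parity n _ hn
    exact ⟨n, hyI.1 ((hS.inner_congr hx hy hyx).2 hxI), hn⟩
  · intro hxI
    refine ⟨⟨x, hx, rfl⟩, ?_⟩
    rintro ⟨-, n, hodd, hn⟩
    obtain ⟨y, hy, hyx, hyI⟩ := parity n _ hn
    exact hxI ((hS.inner_congr hx hy hyx).1 (hyI.2 hodd))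

theorem mono_below {S' : Struct V} {ρ' : V} (hS : AltTree M l I r ρ S) {l' : V × V → ℕ}
    {I' : Set V} {r' : V → ℕ} (hS' : AltTree M l' I' r' ρ' S')
    (hv : S'.verts ⊆ S.verts) (ha : S'.arcs ⊆ S.arcs) (hb : S'.blossoms ⊆ S.blossoms) {v : V}
    (h : v ∈ S'.verts) : S'.below v ⊆ S.below v := by
  refine hS'.below_subset (mem_below_self (hv h)) ?_ fun x y hx hxy => hS.below_arc hx (ha hxy)
  rintro x hx y ⟨B, hB, h1, h2⟩
  exact hS.below_root hx ⟨B, hb hB, h1, h2⟩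

/-- Labels, inner set and ranks are global, so an operation on one structure changes them for all;
the others notice nothing as long as the changes are outside their vertices. -/
theorem congr (hS : AltTree M l I r ρ S) {l' : V × V → ℕ} {I' : Set V} {r' : V → ℕ}
    (hl : ∀ x ∈ S.verts, x ∈ I → ∀ t, M.Adj x t → l' (x, t) = l (x, t))
    (hI : ∀ x ∈ S.verts, (x ∈ I' ↔ x ∈ I)) (hr : ∀ x ∈ S.verts, r' x = r x) :
    AltTree M l' I' r' ρ S where
  mem := hS.mem
  blossom_sub := hS.blossom_sub
  exists_blossom := hS.exists_blossom
  root_eq := hS.root_eq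
  arcs_sub := hS.arcs_sub
  inner_root x hx hxI := hS.inner_root x hx ((hI x hx).1 hxI)
  rank_root x y hy := by
    have hx : x ∈ S.verts := by
      obtain ⟨B, hB, h, -⟩ := hy
      exact hS.blossom_sub B hB h
    rw [hr x hx, hr y (hS.root_subset _ hy)]
    exact hS.rank_root x y hy
  inner_child x hx hxI := by
    obtain ⟨t, h1, h2, h3⟩ := hS.inner_child x hx ((hI x hx).1 hxI)
    exact ⟨t, (hI t (hS.arcs_sub _ _ h3).2).not.2 h1, h2, h3⟩
  label_eq x hx hxI t ht := by
    have := (hI x hx).1 hxI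
    rw [hl x hx this t ht, hr x hx, hS.label_eq x hx this t ht]
  cross x y hxy hne := by
    obtain ⟨hx, hy⟩ := hS.arcs_sub _ _ hxy
    rw [hI x hx, hI y hy, hr x hx, hr y hy]
    exact hS.cross x y hxy hne
  outer_mate y hy hyI z hz := by
    rcases hS.outer_mate y hy ((hI y hy).not.1 hyI) z hz with h | h
    · exact .inl h
    · exact .inr ⟨(hI z h.2).2 h.1, h.2⟩
  unique := hS.unique
  no_parent := hS.no_parent
  parent := hS.parent

theorem set_work (hS : AltTree M l I r ρ S) (w : Option (Set V)) :
    AltTree M l I r ρ { S with work := w } :=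
  ⟨hS.1, hS.2, hS.3, hS.4, hS.5, hS.6, hS.7, hS.8, hS.9, hS.10, hS.11, hS.12, hS.13, hS.14⟩

end AltTree

end Trees


/-! ### Cutting a tree at an inner vertex -/

section Surgery

variable {V : Type*} {G : SimpleGraph V}

/-- The part of a structure below `v`. -/
def Struct.piece (T : Struct V) (v : V) : Struct V :=
  ⟨T.below v, T.arcsIn (T.below v), T.blossomsIn (T.below v), none⟩

/-- What is left of a structure when the part below `v`, entered by the arc `(p, v)`, is cut off. -/
def Struct.pruned (T : Struct V) (p v : V) (w : Option (Set V)) : Struct V :=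
  ⟨T.verts \ T.below v, (T.arcs \ {(p, v)}) \ T.arcsIn (T.below v),
    T.blossoms \ T.blossomsIn (T.below v), w⟩

/-- The structure obtained by attaching `P` to `S` by the arc `(u, v)`. -/
def Struct.graft (S P : Struct V) (u v : V) (w : Option (Set V)) : Struct V :=
  ⟨S.verts ∪ P.verts, S.arcs ∪ {(u, v)} ∪ P.arcs, S.blossoms ∪ P.blossoms, w⟩

namespace AltTree

variable {M : G.Subgraph} {l : V × V → ℕ} {I : Set V} {r : V → ℕ} {ρ : V} {S T : Struct V}

theorem blossom_subset_root {B : Blossom V} (hB : B ∈ T.blossoms) {x : V} (hx : x ∈ B.verts) :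
    B.verts ⊆ T.root x := fun _ hy => ⟨B, hB, hx, hy⟩

theorem root_piece (hT : AltTree M l I r ρ T) {v x : V} (hx : x ∈ T.below v) :
    (T.piece v).root x = T.root x := by
  ext y
  constructor
  · rintro ⟨B, hB, h⟩
    exact ⟨B, hB.1, h⟩
  · rintro ⟨B, hB, h⟩
    exact ⟨B, ⟨hB, fun z hz => hT.below_root hx (blossom_subset_root hB h.1 hz)⟩, h⟩

theorem root_pruned {p v x : V} {w : Option (Set V)}
    (hx : x ∉ T.below v) : (T.pruned p v w).root x = T.root x := by
  ext y
  constructor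
  · rintro ⟨B, hB, h⟩
    exact ⟨B, hB.1, h⟩
  · rintro ⟨B, hB, h⟩
    exact ⟨B, ⟨hB, fun h' => hx (h'.2 h.1)⟩, h⟩

theorem subset_below_of_mem (hT : AltTree M l I r ρ T) {v x : V} {B : Blossom V}
    (hB : B ∈ T.blossoms) (hxB : x ∈ B.verts) (hx : x ∈ T.below v) : B.verts ⊆ T.below v :=
  fun _ hz => hT.below_root hx (blossom_subset_root hB hxB hz)

/-- Above an inner vertex `v`, the parent of a vertex below `v` is `v` or below `v`. -/
theorem arc_mem_below (hT : AltTree M l I r ρ T) {p v : V} (hvI : v ∈ I) (hpv : (p, v) ∈ T.arcs)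
    (hp : T.root p ≠ T.root v) {x y : V} (hxy : (x, y) ∈ T.arcs) (hy : y ∈ T.below v)
    (hne : (x, y) ≠ (p, v)) : x ∈ T.below v := by
  obtain ⟨hxv, hyv⟩ := hT.arcs_sub _ _ hxy
  by_cases hc : T.root x = T.root y
  · exact hT.below_of_root_eq hy hxv hc
  · by_cases hyv' : T.root y = T.root v
    · obtain ⟨rfl, rfl⟩ := hT.unique x y p v hxy hpv hc hp hyv'
      exact absurd rfl hne
    · exact hT.parent_mem_below hy hyv' hxy rfl hc

/-- No arc leaves the part below `v`, and only `(p, v)` enters it. Root blossoms lie on one side of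
the cut, so all conditions are inherited. -/
theorem pruned (hT : AltTree M l I r ρ T) (hM : M.IsMatching) {p v : V} (hvI : v ∈ I)
    (hpv : (p, v) ∈ T.arcs) (hp : T.root p ≠ T.root v) (w : Option (Set V)) :
    AltTree M l I r ρ (T.pruned p v w) := by
  obtain ⟨hpV, hvV⟩ := hT.arcs_sub _ _ hpv
  have hρ : ρ ∉ T.below v := hT.root_notMem_below (hT.no_parent p v hpv hp)
  have hvb : v ∈ T.below v := mem_below_self hvV
  have hroot : ∀ x ∉ T.below v, (T.pruned p v w).root x = T.root x := fun x => root_pruned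
  have hout : ∀ x y, y ∈ (T.pruned p v w).root x → x ∉ T.below v := by
    rintro x y ⟨B, ⟨hB, hBn⟩, hx, -⟩ hxb
    exact hBn ⟨hB, hT.subset_below_of_mem hB hx hxb⟩
  have hsymm : ∀ x y, y ∈ (T.pruned p v w).root x → x ∈ (T.pruned p v w).root y :=
    fun x y ⟨B, hB, h1, h2⟩ => ⟨B, hB, h2, h1⟩
  have harcs : ∀ x y, (x, y) ∈ (T.pruned p v w).arcs →
      (x, y) ∈ T.arcs ∧ x ∉ T.below v ∧ y ∉ T.below v := by
    rintro x y ⟨⟨hxy, hne⟩, hn⟩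
    have hx : x ∉ T.below v := fun hx => hn ⟨hxy, hx, hT.below_arc hx hxy⟩
    exact ⟨hxy, hx, fun hy => hx (hT.arc_mem_below hvI hpv hp hxy hy hne)⟩
  have harcs' : ∀ x y, (x, y) ∈ T.arcs → y ∉ T.below v → (x, y) ∈ (T.pruned p v w).arcs := by
    intro x y hxy hy
    refine ⟨⟨hxy, ?_⟩, fun h => hy h.2.2⟩
    rintro h
    obtain ⟨rfl, rfl⟩ := Prod.mk.inj (Set.mem_singleton_iff.1 h)
    exact hy hvb
  refine ⟨⟨hT.mem, hρ⟩, ?_, ?_, ?_, ?_, ?_, ?_, ?_, ?_, ?_, ?_, ?_, ?_, ?_⟩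
  · rintro B ⟨hB, hBn⟩ x hx
    exact ⟨hT.blossom_sub B hB hx, fun hxb => hBn ⟨hB, hT.subset_below_of_mem hB hx hxb⟩⟩
  · rintro x ⟨hx, hxb⟩
    obtain ⟨B, hB, hxB, h⟩ := hT.exists_blossom x hx
    exact ⟨B, ⟨hB, fun h' => hxb (h'.2 hxB)⟩, hxB, by rw [h, hroot x hxb]⟩
  · intro x y hy
    have hx := hout x y hy
    have hy' := hout y x (hsymm x y hy)
    rw [hroot x hx] at hy
    rw [hroot x hx, hroot y hy']
    exact hT.root_eq x y hy
  · intro x y hxy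
    obtain ⟨h1, h2, h3⟩ := harcs x y hxy
    exact ⟨⟨(hT.arcs_sub _ _ h1).1, h2⟩, ⟨(hT.arcs_sub _ _ h1).2, h3⟩⟩
  · rintro x ⟨hx, hxb⟩ hxI
    rw [hroot x hxb]
    exact hT.inner_root x hx hxI
  · intro x y hy
    rw [hroot x (hout x y hy)] at hy
    exact hT.rank_root x y hy
  · rintro x ⟨hx, hxb⟩ hxI
    obtain ⟨t, h1, h2, h3⟩ := hT.inner_child x hx hxI
    -- The arc to the mate survives: its head is outer, so it is not the deleted arc, whose head `v`
    -- is inner.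
    refine ⟨t, h1, h2, harcs' x t h3 fun ht => hxb (hT.arc_mem_below hvI hpv hp h3 ht ?_)⟩
    rintro h
    obtain ⟨rfl, rfl⟩ := Prod.mk.inj h
    exact h1 hvI
  · rintro x ⟨hx, -⟩ hxI
    exact hT.label_eq x hx hxI
  · intro x y hxy hne
    obtain ⟨h1, h2, h3⟩ := harcs x y hxy
    rw [hroot x h2, hroot y h3] at hne
    exact hT.cross x y h1 hne
  · rintro y ⟨hy, hyb⟩ hyI z hz
    rw [hroot y hyb]
    rcases hT.outer_mate y hy hyI z hz with h | ⟨h1, h2⟩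
    · exact .inl h
    · exact .inr ⟨h1, h2, fun h3 => hyb (hT.below_arc h3 (hT.child_eq hM h2 h1 hz).2.1)⟩
  · intro x y x' y' hxy hxy' hne hne' h
    obtain ⟨h1, h2, h3⟩ := harcs x y hxy
    obtain ⟨h1', h2', h3'⟩ := harcs x' y' hxy'
    rw [hroot x h2, hroot y h3] at hne
    rw [hroot x' h2', hroot y' h3'] at hne'
    rw [hroot y h3, hroot y' h3'] at h
    exact hT.unique x y x' y' h1 h1' hne hne' h
  · intro x y hxy hne
    obtain ⟨h1, h2, h3⟩ := harcs x y hxy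
    rw [hroot x h2, hroot y h3] at hne
    rw [hroot y h3, hroot ρ hρ]
    exact hT.no_parent x y h1 hne
  · rintro x ⟨hx, hxb⟩ hne
    rw [hroot x hxb, hroot ρ hρ] at hne
    obtain ⟨z, y, h1, h2, h3⟩ := hT.parent x hx hne
    obtain ⟨hz, hy⟩ := hT.arcs_sub _ _ h1
    have hyb : y ∉ T.below v := fun h => hxb (hT.below_of_root_eq h hx h2.symm)
    have hzb : z ∉ T.below v := fun h => hyb (hT.below_arc h h1)
    refine ⟨z, y, harcs' z y h1 hyb, ?_, ?_⟩
    · rw [hroot y hyb, hroot x hxb, h2]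
    · rwa [hroot z hzb, hroot x hxb]

/-- The new root `v` is inner; for this reason `AltTree` leaves the kind of the root open, and the
requirement that it be outer appears only in `Struct.Good`. -/
theorem piece (hT : AltTree M l I r ρ T) (hM : M.IsMatching) {p v : V} (hvI : v ∈ I)
    (hpv : (p, v) ∈ T.arcs) (hp : T.root p ≠ T.root v) :
    AltTree M l I r v (T.piece v) := by
  obtain ⟨hpV, hvV⟩ := hT.arcs_sub _ _ hpv
  have hρ : ρ ∉ T.below v := hT.root_notMem_below (hT.no_parent p v hpv hp)
  have hpb : p ∉ T.below v := hT.parent_notMem_below hpv hp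
  have hvb : v ∈ T.below v := mem_below_self hvV
  have hroot : ∀ x ∈ T.below v, (T.piece v).root x = T.root x := fun x => hT.root_piece
  have hin : ∀ x y, y ∈ (T.piece v).root x → x ∈ T.below v := by
    rintro x y ⟨B, ⟨hB, hBs⟩, hx, -⟩
    exact hBs hx
  have hsymm : ∀ x y, y ∈ (T.piece v).root x → x ∈ (T.piece v).root y :=
    fun x y ⟨B, hB, h1, h2⟩ => ⟨B, hB, h2, h1⟩
  refine ⟨hvb, ?_, ?_, ?_, ?_, ?_, ?_, ?_, ?_, ?_, ?_, ?_, ?_, ?_⟩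
  · rintro B ⟨hB, hBs⟩
    exact hBs
  · intro x hx
    obtain ⟨B, hB, hxB, h⟩ := hT.exists_blossom x hx.1
    exact ⟨B, ⟨hB, hT.subset_below_of_mem hB hxB hx⟩, hxB, by rw [h, hroot x hx]⟩
  · intro x y hy
    have hx := hin x y hy
    have hy' := hin y x (hsymm x y hy)
    rw [hroot x hx] at hy
    rw [hroot x hx, hroot y hy']
    exact hT.root_eq x y hy
  · rintro x y ⟨-, h⟩
    exact h
  · intro x hx hxI
    rw [hroot x hx]
    exact hT.inner_root x hx.1 hxI
  · intro x y hy
    rw [hroot x (hin x y hy)] at hy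
    exact hT.rank_root x y hy
  · intro x hx hxI
    obtain ⟨t, h1, h2, h3⟩ := hT.inner_child x hx.1 hxI
    exact ⟨t, h1, h2, h3, hx, hT.below_arc hx h3⟩
  · intro x hx hxI
    exact hT.label_eq x hx.1 hxI
  · rintro x y ⟨h1, h2, h3⟩ hne
    rw [hroot x h2, hroot y h3] at hne
    exact hT.cross x y h1 hne
  · intro y hy hyI z hz
    rw [hroot y hy]
    rcases hT.outer_mate y hy.1 hyI z hz with h | ⟨h1, h2⟩
    · exact .inl h
    -- The outer `y` is not in the root blossom of the inner `v`, so its parent `z` is still below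
    -- `v`.
    · obtain ⟨-, h3, h4⟩ := hT.child_eq hM h2 h1 hz
      exact .inr ⟨h1, hT.parent_mem_below hy (hT.root_ne_of_inner_outer hvV hy.1 hvI hyI).symm
        h3 rfl h4⟩
  · rintro x y x' y' ⟨h1, h2, h3⟩ ⟨h1', h2', h3'⟩ hne hne' h
    rw [hroot x h2, hroot y h3] at hne
    rw [hroot x' h2', hroot y' h3'] at hne'
    rw [hroot y h3, hroot y' h3'] at h
    exact hT.unique x y x' y' h1 h1' hne hne' h
  · rintro x y ⟨h1, h2, h3⟩ hne h
    rw [hroot x h2, hroot y h3] at hne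
    rw [hroot y h3, hroot v hvb] at h
    obtain ⟨rfl, rfl⟩ := hT.unique x y p v h1 hpv hne hp h
    exact hpb h2
  · intro x hx hne
    rw [hroot x hx, hroot v hvb] at hne
    obtain ⟨z, y, h1, h2, h3⟩ := hT.parent x hx.1 fun h => hρ (hT.below_of_root_eq hx hT.mem h.symm)
    have hz : z ∈ T.below v := hT.parent_mem_below hx hne h1 h2 (h2 ▸ h3)
    refine ⟨z, y, ⟨h1, hz, hT.below_arc hz h1⟩, ?_, ?_⟩
    · rw [hroot y (hT.below_arc hz h1), hroot x hx, h2]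
    · rwa [hroot z hz, hroot x hx]

end AltTree

end Surgery


/-! ### Relabelling and attaching a subtree -/

section Grafting

variable {V : Type*} {G : SimpleGraph V}

namespace AltTree

variable {M : G.Subgraph} {l : V × V → ℕ} {I : Set V} {r : V → ℕ} {ρ : V} {S T P : Struct V}

open Classical in
/-- Lowering the label of the matched arc leaving the root of a tree with inner root. -/
theorem relabel {v t : V} (hP : AltTree M l I r v P) (hM : M.IsMatching) (hvI : v ∈ I)
    (hvt : M.Adj v t) {k : ℕ} (hk : k ≤ r v) :
    AltTree M (Function.update l (v, t) k) I
      (fun x => if x = v ∨ x ∈ P.root t then k else r x) v P := by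
  obtain ⟨htI, hvta, hne⟩ := hP.child_eq hM hP.mem hvI hvt
  obtain ⟨-, htV⟩ := hP.arcs_sub _ _ hvta
  have hrt : r t = r v := by
    rcases hP.cross v t hvta hne with h | h
    · exact absurd h.2.1 htI
    · exact h.2.2.2.symm
  have hroot_v : ∀ x ∈ P.verts, P.root x = P.root v → x = v := fun x hx h =>
    hP.eq_of_inner hP.mem hx hvI h
  have hle : ∀ x, (if x = v ∨ x ∈ P.root t then k else r x) ≤ r x := by
    intro x
    split_ifs with h
    · rcases h with rfl | h
      · exact hk
      · rw [hP.rank_root t x h, hrt]; exact hk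
    · exact le_rfl
  have hin : ∀ x ∈ P.verts, x ∈ I → x ∉ P.root t := fun x hx hxI h =>
    hP.root_ne_of_inner_outer hx htV hxI htI (hP.root_eq t x h)
  refine { hP with rank_root := ?_, label_eq := ?_, cross := ?_ }
  · intro x y hy
    have hyV := hP.root_subset _ hy
    have hxV : x ∈ P.verts := by
      obtain ⟨B, hB, h, -⟩ := hy
      exact hP.blossom_sub B hB h
    have hyx := hP.root_eq x y hy
    have h1 : y = v ↔ x = v := by
      constructor
      · rintro rfl; exact hroot_v x hxV hyx.symm
      · rintro rfl; exact hroot_v y hyV hyx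
    have h2 : y ∈ P.root t ↔ x ∈ P.root t := by
      constructor
      · intro h; exact hP.mem_root_of_eq hxV (hyx.symm.trans (hP.root_eq _ _ h))
      · intro h; exact hP.mem_root_of_eq hyV (hyx.trans (hP.root_eq _ _ h))
    simp only [h1, h2, hP.rank_root x y hy]
  · intro x hx hxI z hz
    by_cases hxv : x = v
    · subst hxv
      obtain rfl := hM.eq_of_adj_left hvt hz
      simp
    · have hne' : (x, z) ≠ (v, t) := fun h => hxv (Prod.mk.inj h).1
      rw [Function.update_of_ne hne', hP.label_eq x hx hxI z hz, if_neg]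
      rintro (h | h)
      · exact hxv h
      · exact hin x hx hxI h
  · intro x y hxy hc
    obtain ⟨hxV, hyV⟩ := hP.arcs_sub _ _ hxy
    rcases hP.cross x y hxy hc with ⟨h1, h2, h3⟩ | ⟨h1, h2, h3, h4⟩
    · refine .inl ⟨h1, h2, ?_⟩
      have hyv : ¬(y = v ∨ y ∈ P.root t) := by
        rintro (rfl | h)
        · exact hP.no_parent x y hxy hc rfl
        · exact hin y hyV h2 h
      rw [if_neg hyv]
      exact (hle x).trans_lt h3
    · refine .inr ⟨h1, h2, h3, ?_⟩
      by_cases hxv : x = v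
      · subst hxv
        obtain rfl := hM.eq_of_adj_left hvt h3
        simp [hP.mem_root_self htV]
      · rw [if_neg, if_neg]
        · exact h4
        · rintro (rfl | h)
          · exact h2 hvI
          · exact hxv (hP.unique x y v t hxy hvta hc hne (hP.root_eq _ _ h)).1
        · rintro (h | h)
          · exact hxv h
          · exact hin x hxV h1 h

theorem root_graft_left (hP : AltTree M l I r ρ P) (hd : Disjoint S.verts P.verts) {x u v : V}
    {w : Option (Set V)} (hx : x ∈ S.verts) : (S.graft P u v w).root x = S.root x := by
  ext y
  constructor
  · rintro ⟨B, hB | hB, h⟩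
    · exact ⟨B, hB, h⟩
    · exact absurd (hP.blossom_sub B hB h.1) (Set.disjoint_left.1 hd hx)
  · rintro ⟨B, hB, h⟩
    exact ⟨B, .inl hB, h⟩

theorem root_graft_right (hS : AltTree M l I r ρ S) (hd : Disjoint S.verts P.verts) {x u v : V}
    {w : Option (Set V)} (hx : x ∈ P.verts) : (S.graft P u v w).root x = P.root x := by
  ext y
  constructor
  · rintro ⟨B, hB | hB, h⟩
    · exact absurd hx (Set.disjoint_left.1 hd (hS.blossom_sub B hB h.1))
    · exact ⟨B, hB, h⟩
  · rintro ⟨B, hB, h⟩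
    exact ⟨B, .inr hB, h⟩

/-- Since `v` has no parent in `P`, the arc `(u, v)` is its only entering arc afterwards, and `r u <
r v` is just what an arc from outer to inner needs. By disjointness no root blossom changes. -/
theorem graft {u v : V} (hS : AltTree M l I r ρ S) (hP : AltTree M l I r v P) (hvI : v ∈ I)
    (hd : Disjoint S.verts P.verts) (hu : u ∈ S.verts) (huI : u ∉ I) (huv : r u < r v)
    (w : Option (Set V)) : AltTree M l I r ρ (S.graft P u v w) := by
  have hl : ∀ x ∈ S.verts, (S.graft P u v w).root x = S.root x :=
    fun x => hP.root_graft_left hd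
  have hr : ∀ x ∈ P.verts, (S.graft P u v w).root x = P.root x :=
    fun x => hS.root_graft_right hd
  have hmem : ∀ x y, y ∈ (S.graft P u v w).root x →
      (x ∈ S.verts ∧ y ∈ S.root x) ∨ (x ∈ P.verts ∧ y ∈ P.root x) := by
    rintro x y ⟨B, hB | hB, h⟩
    · exact .inl ⟨hS.blossom_sub B hB h.1, B, hB, h⟩
    · exact .inr ⟨hP.blossom_sub B hB h.1, B, hB, h⟩
  have hnd : ∀ x ∈ S.verts, ∀ y ∈ P.verts, S.root x ≠ P.root y := by
    intro x hx y hy h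
    exact Set.disjoint_left.1 hd hx (hP.root_subset y (h ▸ hS.mem_root_self hx))
  have huv' : S.root u ≠ P.root v := hnd u hu v hP.mem
  have harc : ∀ x y, (x, y) ∈ (S.graft P u v w).arcs →
      (S.graft P u v w).root x ≠ (S.graft P u v w).root y →
      ((x, y) ∈ S.arcs ∧ S.root x ≠ S.root y ∧ y ∈ S.verts ∧
        (S.graft P u v w).root y = S.root y) ∨ (x = u ∧ y = v) ∨
      ((x, y) ∈ P.arcs ∧ P.root x ≠ P.root y ∧ y ∈ P.verts ∧
        (S.graft P u v w).root y = P.root y ∧ P.root y ≠ P.root v) := by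
    rintro x y ((h | h) | h) hne
    · obtain ⟨hx, hy⟩ := hS.arcs_sub _ _ h
      rw [hl x hx, hl y hy] at hne
      exact .inl ⟨h, hne, hy, hl y hy⟩
    · exact .inr (.inl (Prod.mk.inj (Set.mem_singleton_iff.1 h)))
    · obtain ⟨hx, hy⟩ := hP.arcs_sub _ _ h
      rw [hr x hx, hr y hy] at hne
      exact .inr (.inr ⟨h, hne, hy, hr y hy, hP.no_parent x y h hne⟩)
  refine ⟨.inl hS.mem, ?_, ?_, ?_, ?_, ?_, ?_, ?_, ?_, ?_, ?_, ?_, ?_, ?_⟩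
  · rintro B (hB | hB) x hx
    · exact .inl (hS.blossom_sub B hB hx)
    · exact .inr (hP.blossom_sub B hB hx)
  · rintro x (hx | hx)
    · obtain ⟨B, hB, h⟩ := hS.exists_blossom x hx
      exact ⟨B, .inl hB, by rwa [hl x hx]⟩
    · obtain ⟨B, hB, h⟩ := hP.exists_blossom x hx
      exact ⟨B, .inr hB, by rwa [hr x hx]⟩
  · intro x y hy
    rcases hmem x y hy with ⟨hx, h⟩ | ⟨hx, h⟩
    · rw [hl x hx, hl y (hS.root_subset _ h), hS.root_eq x y h]
    · rw [hr x hx, hr y (hP.root_subset _ h), hP.root_eq x y h]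
  · rintro x y ((h | h) | h)
    · exact ⟨.inl (hS.arcs_sub _ _ h).1, .inl (hS.arcs_sub _ _ h).2⟩
    · obtain ⟨rfl, rfl⟩ := Prod.mk.inj (Set.mem_singleton_iff.1 h)
      exact ⟨.inl hu, .inr hP.mem⟩
    · exact ⟨.inr (hP.arcs_sub _ _ h).1, .inr (hP.arcs_sub _ _ h).2⟩
  · rintro x (hx | hx) hxI
    · rw [hl x hx, hS.inner_root x hx hxI]
    · rw [hr x hx, hP.inner_root x hx hxI]
  · intro x y hy
    rcases hmem x y hy with ⟨hx, h⟩ | ⟨hx, h⟩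
    · exact hS.rank_root x y h
    · exact hP.rank_root x y h
  · rintro x (hx | hx) hxI
    · obtain ⟨t, h1, h2, h3⟩ := hS.inner_child x hx hxI
      exact ⟨t, h1, h2, .inl (.inl h3)⟩
    · obtain ⟨t, h1, h2, h3⟩ := hP.inner_child x hx hxI
      exact ⟨t, h1, h2, .inr h3⟩
  · rintro x (hx | hx) hxI
    · exact hS.label_eq x hx hxI
    · exact hP.label_eq x hx hxI
  · intro x y hxy hne
    rcases harc x y hxy hne with ⟨h1, h2, -⟩ | ⟨rfl, rfl⟩ | ⟨h1, h2, -⟩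
    · exact hS.cross x y h1 h2
    · exact .inl ⟨huI, hvI, huv⟩
    · exact hP.cross x y h1 h2
  · rintro y (hy | hy) hyI z hz
    · rcases hS.outer_mate y hy hyI z hz with h | h
      · exact .inl (by rwa [hl y hy])
      · exact .inr ⟨h.1, .inl h.2⟩
    · rcases hP.outer_mate y hy hyI z hz with h | h
      · exact .inl (by rwa [hr y hy])
      · exact .inr ⟨h.1, .inr h.2⟩
  · intro x y x' y' hxy hxy' hne hne' h
    rcases harc x y hxy hne with ⟨h1, h2, h3, h4⟩ | ⟨rfl, rfl⟩ | ⟨h1, h2, h3, h4, h5⟩ <;>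
    rcases harc x' y' hxy' hne' with ⟨h1', h2', h3', h4'⟩ | ⟨rfl, rfl⟩ | ⟨h1', h2', h3', h4', h5'⟩
    · exact hS.unique x y x' y' h1 h1' h2 h2' (by rw [← h4, ← h4', h])
    · rw [h4, hr _ hP.mem] at h
      exact absurd h (hnd _ h3 _ hP.mem)
    · rw [h4, h4'] at h
      exact absurd h (hnd _ h3 _ h3')
    · rw [h4', hr _ hP.mem] at h
      exact absurd h.symm (hnd _ h3' _ hP.mem)
    · exact ⟨rfl, rfl⟩
    · rw [h4', hr _ hP.mem] at h
      exact absurd h.symm h5'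
    · rw [h4, h4'] at h
      exact absurd h.symm (hnd _ h3' _ h3)
    · rw [h4, hr _ hP.mem] at h
      exact absurd h h5
    · exact hP.unique x y x' y' h1 h1' h2 h2' (by rw [← h4, ← h4', h])
  · intro x y hxy hne
    rw [hl ρ hS.mem]
    rcases harc x y hxy hne with ⟨h1, h2, h3, h4⟩ | ⟨rfl, rfl⟩ | ⟨h1, h2, h3, h4, h5⟩
    · rw [h4]
      exact hS.no_parent x y h1 h2
    · rw [hr _ hP.mem]
      exact (hnd _ hS.mem _ hP.mem).symm
    · rw [h4]
      exact (hnd _ hS.mem _ h3).symm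
  · rw [hl ρ hS.mem]
    rintro x (hx | hx) hne
    · rw [hl x hx] at hne ⊢
      obtain ⟨z, y, h1, h2, h3⟩ := hS.parent x hx hne
      obtain ⟨hz, hy⟩ := hS.arcs_sub _ _ h1
      exact ⟨z, y, .inl (.inl h1), by rw [hl y hy, h2], by rwa [hl z hz]⟩
    · rw [hr x hx]
      by_cases hxv : P.root x = P.root v
      · exact ⟨u, v, .inl (.inr rfl), by rw [hr v hP.mem, hxv], by rwa [hl u hu, hxv]⟩
      · obtain ⟨z, y, h1, h2, h3⟩ := hP.parent x hx hxv
        obtain ⟨hz, hy⟩ := hP.arcs_sub _ _ h1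
        exact ⟨z, y, .inr h1, by rw [hr y hy, h2], by rwa [hr z hz]⟩

/-- Grafting changes what is below a vertex only above the place where it happens. -/
theorem below_graft_left {u v x : V} {w : Option (Set V)} (hS : AltTree M l I r ρ S)
    (hP : AltTree M l I r v P) (hd : Disjoint S.verts P.verts)
    (hSP : AltTree M l I r ρ (S.graft P u v w)) (hx : x ∈ S.verts) (hu : u ∉ S.below x) :
    (S.graft P u v w).below x ⊆ S.below x := by
  refine hSP.below_subset (mem_below_self hx) ?_ ?_
  · intro y hy z hz
    rw [hP.root_graft_left hd hy.1] at hz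
    exact hS.below_root hy hz
  · rintro y z hy ((h | h) | h)
    · exact hS.below_arc hy h
    · exact absurd ((Prod.mk.inj (Set.mem_singleton_iff.1 h)).1 ▸ hy) hu
    · exact absurd (hP.arcs_sub _ _ h).1 (Set.disjoint_left.1 hd hy.1)

theorem below_graft_right {u v x : V} {w : Option (Set V)} (hS : AltTree M l I r ρ S)
    (hP : AltTree M l I r v P) (hd : Disjoint S.verts P.verts) (hu : u ∈ S.verts)
    (hSP : AltTree M l I r ρ (S.graft P u v w)) (hx : x ∈ P.verts) :
    (S.graft P u v w).below x ⊆ P.below x := by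
  refine hSP.below_subset (mem_below_self hx) ?_ ?_
  · intro y hy z hz
    rw [hS.root_graft_right hd hy.1] at hz
    exact hP.below_root hy hz
  · rintro y z hy ((h | h) | h)
    · exact absurd hy.1 (Set.disjoint_left.1 hd (hS.arcs_sub _ _ h).1)
    · obtain ⟨rfl, rfl⟩ := Prod.mk.inj (Set.mem_singleton_iff.1 h)
      exact absurd hy.1 (Set.disjoint_left.1 hd hu)
    · exact hP.below_arc hy h

end AltTree

/-- What is below an inner vertex is bounded in terms of its rank. -/
def BelowBound (K : ℝ) (L : ℕ) (I : Set V) (r : V → ℕ) (S : Struct V) : Prop :=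
  ∀ x ∈ S.verts, x ∈ I → ((S.below x).ncard : ℝ) ≤ K * ((L : ℝ) + 1 - r x)

namespace AltTree

variable [Finite V] {M : G.Subgraph} {l : V × V → ℕ} {I : Set V} {r : V → ℕ} {ρ : V}
  {S T P : Struct V} {K : ℝ} {L : ℕ}

theorem belowBound_mono {S' : Struct V} {ρ' : V} (hS : AltTree M l I r ρ S)
    (hS' : AltTree M l I r ρ' S') (hv : S'.verts ⊆ S.verts) (ha : S'.arcs ⊆ S.arcs)
    (hb : S'.blossoms ⊆ S.blossoms) (h : BelowBound K L I r S) : BelowBound K L I r S' :=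
  fun x hx hxI => le_trans (Nat.cast_le.2 (Set.ncard_le_ncard (hS.mono_below hS' hv ha hb hx)))
    (h x (hv hx) hxI)

/-- Only inner vertices of `S` above `u` gain anything. For them the size of the whole new tree is a
sufficient bound, because their rank is at most `r u`. -/
theorem belowBound_graft {u v : V} {w : Option (Set V)} (hS : AltTree M l I r ρ S)
    (hP : AltTree M l I r v P) (hd : Disjoint S.verts P.verts) (hu : u ∈ S.verts)
    (hSP : AltTree M l I r ρ (S.graft P u v w)) (hK : 0 ≤ K) (hbS : BelowBound K L I r S)
    (hbP : BelowBound K L I r P)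
    (hsize : (S.verts.ncard : ℝ) + P.verts.ncard ≤ K * ((L : ℝ) + 1 - r u)) :
    BelowBound K L I r (S.graft P u v w) := by
  rintro x (hx | hx) hxI
  · by_cases hux : u ∈ S.below x
    · have h1 : (S.graft P u v w).below x ⊆ S.verts ∪ P.verts := fun y hy => hy.1
      have h2 := (Set.ncard_le_ncard h1).trans (Set.ncard_union_le _ _)
      have h3 : (r x : ℝ) ≤ r u := Nat.cast_le.2 (hS.rank_le_of_mem_below hx hxI hux)
      calc (((S.graft P u v w).below x).ncard : ℝ) ≤ (S.verts.ncard : ℝ) + P.verts.ncard := by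
            exact_mod_cast h2
        _ ≤ K * ((L : ℝ) + 1 - r u) := hsize
        _ ≤ _ := by gcongr
    · exact le_trans (Nat.cast_le.2 (Set.ncard_le_ncard (hS.below_graft_left hP hd hSP hx hux)))
        (hbS x hx hxI)
  · exact le_trans (Nat.cast_le.2 (Set.ncard_le_ncard (hS.below_graft_right hP hd hu hSP hx)))
      (hbP x hx hxI)

end AltTree

end Grafting


/-! ### The cycle closed by an arc between outer blossoms -/

section Contraction

variable {V : Type*} {G : SimpleGraph V}

/-- `B` is the vertex set of a contractible part of the alternating tree `S`, with top `k`. -/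
structure IsPetal (M : G.Subgraph) (I : Set V) (r : V → ℕ) (S : Struct V) (B : Set V)
    (k : V) : Prop where
  top_mem : k ∈ B
  top_outer : k ∉ I
  subset : B ⊆ S.verts
  root_sub : ∀ x ∈ B, S.root x ⊆ B
  height_le : ∀ x ∈ B, height I r k ≤ height I r x
  parent : ∀ x ∈ B, S.root x ≠ S.root k →
    ∃ z y, (z, y) ∈ S.arcs ∧ z ∈ B ∧ S.root y = S.root x ∧ S.root z ≠ S.root x
  mate_mem : ∀ x ∈ B, x ∈ I → ∀ t, M.Adj x t → t ∈ B

namespace AltTree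

variable {M : G.Subgraph} {l : V × V → ℕ} {I : Set V} {r : V → ℕ} {ρ : V} {S : Struct V}

theorem verts_eq_root (hS : AltTree M l I r ρ S) {B : Blossom V} (hB : S.IsRootBlossom B) {x : V}
    (hx : x ∈ B.verts) : B.verts = S.root x := by
  obtain ⟨C, hC, hxC, h⟩ := hS.exists_blossom x (hS.blossom_sub B hB.1 hx)
  have := hB.2 C hC (h ▸ blossom_subset_root hB.1 hx)
  rw [← this, h]

/-- The top is a blossom of least height on the cycle. A counting argument shows that the closing
arc occurs on the cycle and that every other blossom has its parent there. An inner vertex on the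
cycle has two cycle edges, at most one of which enters it, so it is left through its matched arc. -/
theorem exists_isPetal (hS : AltTree M l I r ρ S) (hM : M.IsMatching) {u v : V}
    (huI : u ∉ I) (hvI : v ∉ I) {m : ℕ} {A : Fin (2 * m + 1) → Blossom V}
    {e : Fin (2 * m + 1) → V × V} {B : Blossom V} (hB : FormsBlossom M m A e B)
    (hA : ∀ i, S.IsRootBlossom (A i))
    (he : ∀ i, e i ∈ insert (u, v) S.arcs ∨ (e i).swap ∈ insert (u, v) S.arcs) :
    u ∈ B.verts ∧ v ∈ B.verts ∧ ∃ k, IsPetal M I r S B.verts k := by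
  classical
  have hm := hB.pos
  obtain ⟨a, ha⟩ : ∃ a : Fin (2 * m + 1) → V, ∀ i, a i = (e i).1 := ⟨_, fun _ => rfl⟩
  obtain ⟨b, hb⟩ : ∃ b : Fin (2 * m + 1) → V, ∀ i, b i = (e i).2 := ⟨_, fun _ => rfl⟩
  have hab : ∀ i, e i = (a i, b i) := fun i => by rw [ha, hb]
  have haA : ∀ i, a i ∈ (A i).verts := fun i => ha i ▸ (hB.edge_mem i).1
  have hbA : ∀ i, b i ∈ (A (i + 1)).verts := fun i => hb i ▸ (hB.edge_mem i).2
  have hAV : ∀ i, (A i).verts ⊆ S.verts := fun i => hS.blossom_sub _ (hA i).1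
  have hAr : ∀ i x, x ∈ (A i).verts → S.root x = S.root (a i) := fun i x hx => by
    rw [← hS.verts_eq_root (hA i) hx, hS.verts_eq_root (hA i) (haA i)]
  have hAa : ∀ i, (A i).verts = S.root (a i) := fun i => hS.verts_eq_root (hA i) (haA i)
  have hinj : ∀ i j, S.root (a i) = S.root (a j) → i = j := by
    intro i j h
    by_contra hij
    refine Set.disjoint_left.1 (hB.disjoint i j hij) (haA i) ?_
    rw [hAa j, ← h, ← hAa i]
    exact haA i
  have hbr : ∀ i, S.root (b i) = S.root (a (i + 1)) := fun i => hAr _ _ (hbA i)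
  -- Here `1 ≤ m` matters: the cycle has at least three blossoms, so no two positions carry edges
  -- between the same two blossoms.
  have htwo : ∀ i : Fin (2 * m + 1), i + 1 + 1 ≠ i := by
    intro i h
    rw [add_assoc] at h
    have h' : (1 + 1 : Fin (2 * m + 1)) = 0 := by simpa using h
    have := congrArg Fin.val h'
    rw [Fin.val_add, Fin.val_one', Fin.val_zero, Nat.mod_eq_of_lt (by omega : 1 < 2 * m + 1),
      Nat.mod_eq_of_lt (by omega)] at this
    omega
  have hone : ∀ i : Fin (2 * m + 1), i + 1 ≠ i := fun i h => htwo i (by rw [h, h])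
  have hne : ∀ i, S.root (a i) ≠ S.root (b i) := fun i h =>
    hone i (hinj _ _ (by rw [h, hbr])).symm
  have hBA : ∀ {x}, x ∈ B.verts ↔ ∃ i, x ∈ (A i).verts := by
    intro x
    rw [hB.verts_eq, Set.mem_iUnion]
  have haB : ∀ i, a i ∈ B.verts := fun i => hBA.2 ⟨i, haA i⟩
  have hbB : ∀ i, b i ∈ B.verts := fun i => hBA.2 ⟨_, hbA i⟩
  have hedge : ∀ i, (a i, b i) ∈ S.arcs ∨ (b i, a i) ∈ S.arcs ∨ (a i = u ∧ b i = v) ∨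
      (a i = v ∧ b i = u) := by
    intro i
    have := he i
    rw [hab i, Set.mem_insert_iff, Set.mem_insert_iff, Prod.swap_prod_mk, Prod.mk.injEq,
      Prod.mk.injEq] at this
    tauto
  -- Positions whose edge is an arc of the tree; at any other position the edge joins `u` and `v`.
  -- For a good position, `c` is the index of the child and `q` that of the parent.
  let good : Fin (2 * m + 1) → Prop := fun i => (a i, b i) ∈ S.arcs ∨ (b i, a i) ∈ S.arcs
  have hex : ∀ i, ∃ c q z y, good i → ((z, y) ∈ S.arcs ∧ S.root z = S.root (a q) ∧
      S.root y = S.root (a c) ∧ z ∈ B.verts ∧ y ∈ B.verts ∧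
      S.root z ≠ S.root y ∧ ((c = i ∧ q = i + 1) ∨ (c = i + 1 ∧ q = i))) := by
    intro i
    by_cases h1 : (a i, b i) ∈ S.arcs
    · exact ⟨i + 1, i, a i, b i, fun _ => ⟨h1, rfl, hbr i, haB i, hbB i, hne i,
        .inr ⟨rfl, rfl⟩⟩⟩
    · by_cases h2 : (b i, a i) ∈ S.arcs
      · exact ⟨i, i + 1, b i, a i, fun _ => ⟨h2, hbr i, rfl, hbB i, haB i, (hne i).symm,
          .inl ⟨rfl, rfl⟩⟩⟩
      · exact ⟨i, i, u, u, fun h => (h.elim h1 h2).elim⟩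
  choose c q z y hc using hex
  obtain ⟨k, hk⟩ := Finite.exists_min fun i => height I r (a i)
  have hkB : ∀ x ∈ B.verts, height I r (a k) ≤ height I r x := by
    intro x hx
    obtain ⟨i, hi⟩ := hBA.1 hx
    exact (hk i).trans (hS.height_congr (hAV i hi) (hAV i (haA i)) (hAr i x hi).symm).le
  have hnoparent : ∀ x y, (x, y) ∈ S.arcs → S.root x ≠ S.root y → S.root y = S.root (a k) →
      x ∉ B.verts := by
    intro x y hxy hxy' hy hx
    have h1 := hS.height_lt hxy hxy'
    rw [hS.height_congr (hAV k (haA k)) (hS.arcs_sub _ _ hxy).2 hy] at h1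
    exact h1.not_ge (hkB x hx)
  -- A tree edge is charged to its child, the closing edge to the top `k`. Parents are unique, `k`
  -- has no parent on the cycle and there is at most one closing edge, so `g` is injective and
  -- therefore bijective.
  let g : Fin (2 * m + 1) → Fin (2 * m + 1) := fun i => if good i then c i else k
  have hck : ∀ i, good i → c i ≠ k := by
    intro i hi h
    obtain ⟨h1, -, h2, h3, -, h4, -⟩ := hc i hi
    exact hnoparent _ _ h1 h4 (h ▸ h2) h3
  have hpair : ∀ i j : Fin (2 * m + 1), (i = j ∨ (i = j + 1 ∧ i + 1 = j)) → i = j := by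
    rintro i j (h | ⟨h1, h2⟩)
    · exact h
    · exact absurd (by rw [← h1, h2]) (htwo j)
  have hg : Function.Injective g := by
    intro i j hij
    by_cases hi : good i <;> by_cases hj : good j
    · simp only [g, if_pos hi, if_pos hj] at hij
      obtain ⟨h1, h2, h3, -, -, h4, h5⟩ := hc i hi
      obtain ⟨h1', h2', h3', -, -, h4', h5'⟩ := hc j hj
      have hz := (hS.unique _ _ _ _ h1 h1' h4 h4' (by rw [h3, h3', hij])).1
      have hq : q i = q j := hinj _ _ (by rw [← h2, ← h2', hz])
      refine hpair i j ?_
      rcases h5 with h5 | h5 <;> rcases h5' with h5' | h5'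
      · exact .inl (by rw [← h5.1, hij, h5'.1])
      · exact .inr ⟨by rw [← h5.1, hij, h5'.1], by rw [← h5.2, hq, h5'.2]⟩
      · exact .inr ⟨by rw [← h5.2, hq, h5'.2], by rw [← h5.1, hij, h5'.1]⟩
      · exact .inl (by rw [← h5.2, hq, h5'.2])
    · simp only [g, if_pos hi, if_neg hj] at hij
      exact absurd hij (hck i hi)
    · simp only [g, if_neg hi, if_pos hj] at hij
      exact absurd hij.symm (hck j hj)
    · have h1 : (a i = u ∧ b i = v) ∨ (a i = v ∧ b i = u) := by
        have := hedge i
        simp only [good] at hi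
        tauto
      have h2 : (a j = u ∧ b j = v) ∨ (a j = v ∧ b j = u) := by
        have := hedge j
        simp only [good] at hj
        tauto
      refine hpair i j ?_
      rcases h1 with h1 | h1 <;> rcases h2 with h2 | h2
      · exact .inl (hinj _ _ (by rw [h1.1, h2.1]))
      · exact .inr ⟨hinj _ _ (by rw [h1.1, ← hbr, h2.2]), hinj _ _ (by rw [h2.1, ← hbr, h1.2])⟩
      · exact .inr ⟨hinj _ _ (by rw [h1.1, ← hbr, h2.2]), hinj _ _ (by rw [h2.1, ← hbr, h1.2])⟩
      · exact .inl (hinj _ _ (by rw [h1.1, h2.1]))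
  have hsurj : Function.Surjective g := Finite.injective_iff_surjective.1 hg
  -- The index `k` is attained by `g`, but not at a good position.
  have hbad : ∃ i, ¬ good i := by
    obtain ⟨i, hi⟩ := hsurj k
    refine ⟨i, fun h => ?_⟩
    simp only [g, if_pos h] at hi
    exact hck i h hi
  have huvB : u ∈ B.verts ∧ v ∈ B.verts := by
    obtain ⟨i, hi⟩ := hbad
    have := hedge i
    simp only [good] at hi
    have h1 := haB i
    have h2 := hbB i
    have h3 : (a i = u ∧ b i = v) ∨ (a i = v ∧ b i = u) := by tauto
    rcases h3 with h | h
    · exact ⟨h.1 ▸ h1, h.2 ▸ h2⟩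
    · exact ⟨h.2 ▸ h2, h.1 ▸ h1⟩
  -- the two edges of the cycle at an inner vertex
  have hinner : ∀ i x, x ∈ (A i).verts → x ∈ I → ∃ y₁ y₂, y₁ ≠ y₂ ∧ y₁ ∈ B.verts ∧ y₂ ∈ B.verts ∧
      S.root x ≠ S.root y₁ ∧ S.root x ≠ S.root y₂ ∧ ((x, y₁) ∈ S.arcs ∨ (y₁, x) ∈ S.arcs) ∧
      ((x, y₂) ∈ S.arcs ∨ (y₂, x) ∈ S.arcs) := by
    intro i x hx hxI
    obtain ⟨j, rfl⟩ : ∃ j, i = j + 1 := ⟨i - 1, by simp⟩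
    have hxV := hAV _ hx
    have hsing : ∀ w ∈ (A (j + 1)).verts, w = x := fun w hw =>
      hS.eq_of_inner hxV (hAV _ hw) hxI ((hAr _ _ hw).trans (hAr _ _ hx).symm)
    have h1 : b j = x := hsing _ (hbA j)
    have h2 : a (j + 1) = x := hsing _ (haA _)
    refine ⟨b (j + 1), a j, ?_, hbB _, haB _, h2 ▸ hne (j + 1), h1 ▸ (hne j).symm, ?_, ?_⟩
    · intro h
      exact htwo j (hinj _ _ (by rw [← hbr, h]))
    · rcases hedge (j + 1) with h | h | h | h
      · exact .inl (h2 ▸ h)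
      · exact .inr (h2 ▸ h)
      · exact absurd (h2.symm.trans h.1 ▸ hxI) huI
      · exact absurd (h2.symm.trans h.1 ▸ hxI) hvI
    · rcases hedge j with h | h | h | h
      · exact .inr (h1 ▸ h)
      · exact .inl (h1 ▸ h)
      · exact absurd (h1.symm.trans h.2 ▸ hxI) hvI
      · exact absurd (h1.symm.trans h.2 ▸ hxI) huI
  have hout : ∀ x y, x ∈ I → (x, y) ∈ S.arcs → S.root x ≠ S.root y → M.Adj x y := by
    intro x y hx hxy hxy'
    rcases hS.cross x y hxy hxy' with h | h
    · exact absurd hx h.1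
    · exact h.2.2.1
  refine ⟨huvB.1, huvB.2, a k, haB k, ?_, ?_, ?_, hkB, ?_, ?_⟩
  -- At an inner top both cycle edges would be outgoing, hence both matched.
  · intro hkI
    obtain ⟨y₁, y₂, h, hy₁, hy₂, hn₁, hn₂, h₁, h₂⟩ := hinner k _ (haA k) hkI
    have h₁' := h₁.resolve_right fun h' => hnoparent _ _ h' hn₁.symm rfl hy₁
    have h₂' := h₂.resolve_right fun h' => hnoparent _ _ h' hn₂.symm rfl hy₂
    exact h (hM.eq_of_adj_left (hout _ _ hkI h₁' hn₁) (hout _ _ hkI h₂' hn₂))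
  · intro x hx
    obtain ⟨i, hi⟩ := hBA.1 hx
    exact hAV i hi
  · intro x hx w hw
    obtain ⟨i, hi⟩ := hBA.1 hx
    refine hBA.2 ⟨i, ?_⟩
    rwa [hS.verts_eq_root (hA i) hi]
  · intro x hx hxk
    obtain ⟨i, hi⟩ := hBA.1 hx
    obtain ⟨j, hj⟩ := hsurj i
    have hjg : good j := by
      by_contra h
      simp only [g, if_neg h] at hj
      exact hxk (by rw [hAr i x hi, hj])
    simp only [g, if_pos hjg] at hj
    obtain ⟨h1, -, h2, h3, -, h4, -⟩ := hc j hjg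
    have h5 : S.root (y j) = S.root x := by rw [h2, hj, hAr i x hi]
    exact ⟨z j, y j, h1, h3, h5, h5 ▸ h4⟩
  · intro x hx hxI t ht
    obtain ⟨i, hi⟩ := hBA.1 hx
    obtain ⟨y₁, y₂, h, hy₁, hy₂, hn₁, hn₂, h₁, h₂⟩ := hinner i x hi hxI
    -- Two entering arcs would contradict the uniqueness of the parent, so one of the edges goes
    -- out, to the mate of `x`.
    rcases h₁ with h₁ | h₁
    · rwa [hM.eq_of_adj_left ht (hout _ _ hxI h₁ hn₁)]
    · rcases h₂ with h₂ | h₂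
      · rwa [hM.eq_of_adj_left ht (hout _ _ hxI h₂ hn₂)]
      · exact absurd (hS.unique _ _ _ _ h₁ h₂ hn₁.symm hn₂.symm rfl).1 h

end AltTree

end Contraction


/-! ### Contracting a petal -/

section Contraction

variable {V : Type*} {G : SimpleGraph V}

/-- The structure obtained by contracting the blossom `B`, closed by the arc `(u, v)`. -/
def Struct.contract (S : Struct V) (u v : V) (B : Blossom V) : Struct V :=
  { S with
    arcs := insert (u, v) S.arcs
    blossoms := insert B S.blossoms
    work := some B.verts }

namespace AltTree

variable {M : G.Subgraph} {l : V × V → ℕ} {I : Set V} {r : V → ℕ} {ρ : V} {S : Struct V}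
  {B : Blossom V} {k u v : V}

theorem root_contract_of_mem (hB : IsPetal M I r S B.verts k) {x : V} (hx : x ∈ B.verts) :
    (S.contract u v B).root x = B.verts := by
  ext y
  constructor
  · rintro ⟨D, rfl | hD, h1, h2⟩
    · exact h2
    · exact hB.root_sub x hx ⟨D, hD, h1, h2⟩
  · exact fun hy => ⟨B, .inl rfl, hx, hy⟩

theorem root_contract_of_notMem {x : V} (hx : x ∉ B.verts) :
    (S.contract u v B).root x = S.root x := by
  ext y
  constructor
  · rintro ⟨D, rfl | hD, h1, h2⟩
    · exact absurd h1 hx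
    · exact ⟨D, hD, h1, h2⟩
  · exact fun ⟨D, hD, h⟩ => ⟨D, .inr hD, h⟩

theorem mem_petal_of_root_eq (hS : AltTree M l I r ρ S) (hB : IsPetal M I r S B.verts k) {x y : V}
    (hx : x ∈ B.verts) (hy : y ∈ S.verts) (h : S.root y = S.root x) : y ∈ B.verts :=
  hB.root_sub x hx (hS.mem_root_of_eq hy h)

/-- An arc entering a petal enters its top. -/
theorem root_eq_top (hS : AltTree M l I r ρ S) (hB : IsPetal M I r S B.verts k) {x y : V}
    (hxy : (x, y) ∈ S.arcs) (hx : x ∉ B.verts) (hy : y ∈ B.verts) : S.root y = S.root k := by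
  by_contra h
  obtain ⟨z, y', h1, h2, h3, h4⟩ := hB.parent y hy h
  have hne : S.root x ≠ S.root y := fun h =>
    hx (hS.mem_petal_of_root_eq hB hy (hS.arcs_sub _ _ hxy).1 h)
  exact hx ((hS.unique _ _ _ _ h1 hxy (h3 ▸ h4) hne h3).1 ▸ h2)

/-- A parent has smaller height than its child, and the top is lowest in the petal. -/
theorem top_no_parent (hS : AltTree M l I r ρ S) (hB : IsPetal M I r S B.verts k) {x y : V}
    (hxy : (x, y) ∈ S.arcs) (hne : S.root x ≠ S.root y) (hy : S.root y = S.root k) :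
    x ∉ B.verts := by
  intro hx
  have h1 := hS.height_lt hxy hne
  rw [hS.height_congr (hB.subset hB.top_mem) (hS.arcs_sub _ _ hxy).2 hy] at h1
  exact h1.not_ge (hB.height_le x hx)

theorem rank_top_le (hB : IsPetal M I r S B.verts k) {x : V} (hx : x ∈ B.verts) : r k ≤ r x := by
  have := hB.height_le x hx
  simp only [height, hB.top_outer, if_false] at this
  split_ifs at this <;> omega

theorem petal_root (hS : AltTree M l I r ρ S) (hB : IsPetal M I r S B.verts k)
    (hρ : ρ ∈ B.verts) : S.root k = S.root ρ := by
  by_contra h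
  obtain ⟨z, y, h1, -, h3, h4⟩ := hB.parent ρ hρ (Ne.symm h)
  exact hS.no_parent z y h1 (h3 ▸ h4) h3

open Classical in
-- The new blossom is outer and takes the rank of its top, through which it is entered. This is the
-- least rank in the petal, so leaving arcs stay strictly increasing. The labels reset to `0` belong
-- to arcs inside the petal, and no remaining inner vertex has its matched arc there.
theorem contract (hS : AltTree M l I r ρ S) (hB : IsPetal M I r S B.verts k)
    (hu : u ∈ B.verts) (hv : v ∈ B.verts) :
    AltTree M (fun a => if M.Adj a.1 a.2 ∧ a.1 ∈ B.verts ∧ a.2 ∈ B.verts then 0 else l a)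
      (I \ B.verts) (fun x => if x ∈ B.verts then r k else r x) ρ (S.contract u v B) := by
  have hin : ∀ x ∈ B.verts, (S.contract u v B).root x = B.verts :=
    fun x => root_contract_of_mem hB
  have hout : ∀ x ∉ B.verts, (S.contract u v B).root x = S.root x :=
    fun x => root_contract_of_notMem
  have hcl : ∀ x ∈ S.verts, x ∉ B.verts → ∀ y ∈ S.root x, y ∉ B.verts := fun x hx hxB y hy hyB =>
    hxB (hS.mem_petal_of_root_eq hB hyB hx (hS.root_eq _ _ hy).symm)
  have hmix : ∀ x ∈ S.verts, x ∉ B.verts → S.root x ≠ B.verts := fun x hx hxB h =>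
    hxB (h ▸ hS.mem_root_self hx)
  have hkV := hB.subset hB.top_mem
  have harc : ∀ x y, (x, y) ∈ (S.contract u v B).arcs →
      (S.contract u v B).root x ≠ (S.contract u v B).root y →
      (x, y) ∈ S.arcs ∧ S.root x ≠ S.root y ∧ ¬(x ∈ B.verts ∧ y ∈ B.verts) := by
    intro x y hxy hne
    have hnot : ¬(x ∈ B.verts ∧ y ∈ B.verts) := fun h => hne (by rw [hin x h.1, hin y h.2])
    rcases hxy with h | h
    · obtain ⟨rfl, rfl⟩ := Prod.mk.inj h
      exact absurd ⟨hu, hv⟩ hnot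
    · refine ⟨h, fun hc => ?_, hnot⟩
      obtain ⟨hx, hy⟩ := hS.arcs_sub _ _ h
      by_cases hxB : x ∈ B.verts
      · exact hnot ⟨hxB, hS.mem_petal_of_root_eq hB hxB hy hc.symm⟩
      · by_cases hyB : y ∈ B.verts
        · exact hxB (hS.mem_petal_of_root_eq hB hyB hx hc)
        · exact hne (by rw [hout x hxB, hout y hyB, hc])
  have htop : ∀ x y, (x, y) ∈ (S.contract u v B).arcs →
      (S.contract u v B).root x ≠ (S.contract u v B).root y → y ∈ B.verts →
      S.root y = S.root k := by
    intro x y hxy hne hy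
    obtain ⟨h1, -, h3⟩ := harc x y hxy hne
    exact hS.root_eq_top hB h1 (fun hx => h3 ⟨hx, hy⟩) hy
  have hSsub : ∀ x ∈ S.verts, (S.contract u v B).root x ⊆ S.verts := by
    intro x hx
    by_cases hxB : x ∈ B.verts
    · rw [hin x hxB]; exact hB.subset
    · rw [hout x hxB]; exact hS.root_subset x
  refine ⟨hS.mem, ?_, ?_, ?_, ?_, ?_, ?_, ?_, ?_, ?_, ?_, ?_, ?_, ?_⟩
  · rintro D (rfl | hD)
    · exact hB.subset
    · exact hS.blossom_sub D hD
  · intro x hx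
    by_cases hxB : x ∈ B.verts
    · exact ⟨B, .inl rfl, hxB, (hin x hxB).symm⟩
    · obtain ⟨D, hD, h⟩ := hS.exists_blossom x hx
      exact ⟨D, .inr hD, by rwa [hout x hxB]⟩
  · intro x y hy
    by_cases hxB : x ∈ B.verts
    · rw [hin x hxB] at hy ⊢
      exact hin y hy
    · rw [hout x hxB] at hy ⊢
      have hxV : x ∈ S.verts := by
        obtain ⟨D, hD, h, -⟩ := hy
        exact hS.blossom_sub D hD h
      rw [hout y (hcl x hxV hxB y hy), hS.root_eq x y hy]
  · rintro x y (h | h)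
    · obtain ⟨rfl, rfl⟩ := Prod.mk.inj h
      exact ⟨hB.subset hu, hB.subset hv⟩
    · exact hS.arcs_sub x y h
  · rintro x hx ⟨hxI, hxB⟩
    rw [hout x hxB, hS.inner_root x hx hxI]
  · intro x y hy
    by_cases hxB : x ∈ B.verts
    · rw [hin x hxB] at hy
      simp [hxB, hy]
    · rw [hout x hxB] at hy
      have hxV : x ∈ S.verts := by
        obtain ⟨D, hD, h, -⟩ := hy
        exact hS.blossom_sub D hD h
      simp [hxB, hcl x hxV hxB y hy, hS.rank_root x y hy]
  · rintro x hx ⟨hxI, hxB⟩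
    obtain ⟨t, h1, h2, h3⟩ := hS.inner_child x hx hxI
    exact ⟨t, fun h => h1 h.1, h2, .inr h3⟩
  · rintro x hx ⟨hxI, hxB⟩ t ht
    simp [hxB, hS.label_eq x hx hxI t ht]
  · intro x y hxy hne
    obtain ⟨h1, h2, h3⟩ := harc x y hxy hne
    obtain ⟨hxV, hyV⟩ := hS.arcs_sub _ _ h1
    by_cases hxB : x ∈ B.verts
    · have hyB : y ∉ B.verts := fun h => h3 ⟨hxB, h⟩
      rcases hS.cross x y h1 h2 with ⟨h4, h5, h6⟩ | ⟨h4, h5, h6, h7⟩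
      · refine .inl ⟨fun h => h4 h.1, ⟨h5, hyB⟩, ?_⟩
        simp only [hxB, hyB, if_true, if_false]
        exact (rank_top_le hB hxB).trans_lt h6
      -- An inner vertex of the petal has its mate inside, so no matched tree arc leaves the petal
      -- from it.
      · exact absurd (hB.mate_mem x hxB h4 y h6) hyB
    · by_cases hyB : y ∈ B.verts
      · have hyk := htop x y hxy hne hyB
        rcases hS.cross x y h1 h2 with ⟨h4, h5, h6⟩ | ⟨h4, h5, h6, h7⟩
        · exact absurd ((hS.inner_congr hkV hyV hyk).1 h5) hB.top_outer
        · refine .inr ⟨⟨h4, hxB⟩, fun h => h5 h.1, h6, ?_⟩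
          simp only [hxB, hyB, if_true, if_false]
          rw [h7, hS.rank_congr hyV hyk]
      · simp only [hxB, hyB, if_false, Set.mem_sdiff, not_false_eq_true, and_true]
        exact hS.cross x y h1 h2
  · intro y hy hyI z hz
    by_cases hyB : y ∈ B.verts
    · rw [hin y hyB]
      by_cases hzB : z ∈ B.verts
      · exact .inl hzB
      · have hyI' : y ∉ I := fun h => hzB (hB.mate_mem y hyB h z hz.symm)
        rcases hS.outer_mate y hy hyI' z hz with h | h
        · exact absurd (hB.root_sub y hyB h) hzB
        · exact .inr ⟨⟨h.1, hzB⟩, h.2⟩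
    · rw [hout y hyB]
      rcases hS.outer_mate y hy (fun h => hyI ⟨h, hyB⟩) z hz with h | h
      · exact .inl h
      · exact .inr ⟨⟨h.1, fun hzB => hyB (hB.mate_mem z hzB h.1 y hz)⟩, h.2⟩
  · intro x y x' y' hxy hxy' hne hne' h
    obtain ⟨h1, h2, h3⟩ := harc x y hxy hne
    obtain ⟨h1', h2', h3'⟩ := harc x' y' hxy' hne'
    refine hS.unique x y x' y' h1 h1' h2 h2' ?_
    by_cases hyB : y ∈ B.verts <;> by_cases hyB' : y' ∈ B.verts
    · rw [htop x y hxy hne hyB, htop x' y' hxy' hne' hyB']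
    · rw [hin y hyB, hout y' hyB'] at h
      exact absurd h.symm (hmix y' (hS.arcs_sub _ _ h1').2 hyB')
    · rw [hin y' hyB', hout y hyB] at h
      exact absurd h (hmix y (hS.arcs_sub _ _ h1).2 hyB)
    · rwa [hout y hyB, hout y' hyB'] at h
  · intro x y hxy hne h
    obtain ⟨h1, h2, h3⟩ := harc x y hxy hne
    refine hS.no_parent x y h1 h2 ?_
    by_cases hyB : y ∈ B.verts <;> by_cases hρB : ρ ∈ B.verts
    · rw [htop x y hxy hne hyB, hS.petal_root hB hρB]
    · rw [hin y hyB, hout ρ hρB] at h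
      exact absurd h.symm (hmix ρ hS.mem hρB)
    · rw [hin ρ hρB, hout y hyB] at h
      exact absurd h (hmix y (hS.arcs_sub _ _ h1).2 hyB)
    · rwa [hout y hyB, hout ρ hρB] at h
  · intro x hx hne
    -- The parent of the new blossom is the old parent of its top, so `k` represents the petal.
    have key : ∃ x' ∈ S.verts, (S.contract u v B).root x' = (S.contract u v B).root x ∧
        S.root x' ≠ S.root ρ ∧ (x' ∈ B.verts → x' = k) := by
      by_cases hxB : x ∈ B.verts
      · refine ⟨k, hkV, by rw [hin x hxB, hin k hB.top_mem], fun h => hne ?_, fun _ => rfl⟩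
        rw [hin x hxB, hin ρ (hS.mem_petal_of_root_eq hB hB.top_mem hS.mem h.symm)]
      · refine ⟨x, hx, rfl, fun h => hne ?_, fun h => absurd h hxB⟩
        rw [hout x hxB, hout ρ (fun h' => hxB (hS.mem_petal_of_root_eq hB h' hx h)), h]
    obtain ⟨x', hx', hxx', hne', hk⟩ := key
    rw [← hxx']
    obtain ⟨z, y, h1, h2, h3⟩ := hS.parent x' hx' hne'
    obtain ⟨hzV, hyV⟩ := hS.arcs_sub _ _ h1
    refine ⟨z, y, .inr h1, ?_, ?_⟩
    · by_cases hxB : x' ∈ B.verts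
      · rw [hin x' hxB, hin y (hS.mem_petal_of_root_eq hB hxB hyV h2)]
      · rw [hout x' hxB, hout y (fun h => hxB (hS.mem_petal_of_root_eq hB h hx' h2.symm)), h2]
    · by_cases hxB : x' ∈ B.verts
      · have hzB : z ∉ B.verts := hS.top_no_parent hB h1 (h2 ▸ h3) (by rw [h2, hk hxB])
        rw [hin x' hxB, hout z hzB]
        exact hmix z hzV hzB
      · rw [hout x' hxB]
        by_cases hzB : z ∈ B.verts
        · rw [hin z hzB]
          exact (hmix x' hx' hxB).symm
        · rwa [hout z hzB]

/-- From `y` one climbs inside the petal to its top without passing the outside vertex `x`; from the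
top every member of the petal is reached downwards. -/
theorem petal_subset_below (hS : AltTree M l I r ρ S) (hB : IsPetal M I r S B.verts k) {x y : V}
    (hx : x ∈ S.verts) (hxB : x ∉ B.verts) (hy : y ∈ S.below x) (hyB : y ∈ B.verts) :
    B.verts ⊆ S.below x := by
  have hkV := hB.subset hB.top_mem
  have up : ∀ n, ∀ y ∈ S.below x, y ∈ B.verts → height I r y = n → k ∈ S.below x := by
    intro n
    induction n using Nat.strong_induction_on with
    | _ n ih =>
      intro y hy hyB hn
      by_cases h : S.root y = S.root k
      · exact hS.below_of_root_eq hy hkV h.symm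
      · obtain ⟨z, y', h1, h2, h3, h4⟩ := hB.parent y hyB h
        refine ih _ ?_ z (hS.parent_mem_below hy (fun h => hxB
          (hS.mem_petal_of_root_eq hB hyB hx h.symm)) h1 h3 (h3 ▸ h4)) h2 rfl
        rw [← hn, ← hS.height_congr hy.1 (hS.arcs_sub _ _ h1).2 h3]
        exact hS.height_lt h1 (h3 ▸ h4)
  have hk := up _ y hy hyB rfl
  have down : ∀ n, ∀ y ∈ B.verts, height I r y = n → y ∈ S.below x := by
    intro n
    induction n using Nat.strong_induction_on with
    | _ n ih =>
      intro y hyB hn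
      by_cases h : S.root y = S.root k
      · exact hS.below_of_root_eq hk (hB.subset hyB) h
      · obtain ⟨z, y', h1, h2, h3, h4⟩ := hB.parent y hyB h
        refine hS.below_of_root_eq (hS.below_arc (ih _ ?_ z h2 rfl) h1) (hB.subset hyB) h3.symm
        rw [← hn, ← hS.height_congr (hB.subset hyB) (hS.arcs_sub _ _ h1).2 h3]
        exact hS.height_lt h1 (h3 ▸ h4)
  exact fun z hz => down _ z hz rfl

open Classical in
theorem belowBound_contract [Finite V] {K : ℝ} {L : ℕ} (hS : AltTree M l I r ρ S)
    (hB : IsPetal M I r S B.verts k) (hu : u ∈ B.verts) (hv : v ∈ B.verts)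
    (h : BelowBound K L I r S) :
    BelowBound K L (I \ B.verts) (fun x => if x ∈ B.verts then r k else r x)
      (S.contract u v B) := by
  rintro x hx ⟨hxI, hxB⟩
  have hS' := hS.contract hB hu hv
  have hsub : (S.contract u v B).below x ⊆ S.below x := by
    refine hS'.below_subset (mem_below_self hx) ?_ ?_
    · intro y hy z hz
      by_cases hyB : y ∈ B.verts
      · rw [root_contract_of_mem hB hyB] at hz
        exact hS.petal_subset_below hB hx hxB hy hyB hz
      · rw [root_contract_of_notMem hyB] at hz
        exact hS.below_root hy hz
    · rintro y z hy (h | h)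
      · obtain ⟨rfl, rfl⟩ := Prod.mk.inj h
        exact hS.petal_subset_below hB hx hxB hy hu hv
      · exact hS.below_arc hy h
  simp only [hxB, if_false]
  exact le_trans (Nat.cast_le.2 (Set.ncard_le_ncard hsub)) (h x hx hxI)

end AltTree

end Contraction


/-! ### The invariant of one structure -/

section Invariant

variable {V : Type*} {G : SimpleGraph V} {M : G.Subgraph} {l : V × V → ℕ} {I : Set V} {r : V → ℕ}
  {K : ℝ} {L : ℕ}

/-- The invariant of a single structure. -/
structure Struct.Good (M : G.Subgraph) (K : ℝ) (L : ℕ) (l : V × V → ℕ) (I : Set V) (r : V → ℕ)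
    (α : V) (S : Struct V) : Prop where
  tree : AltTree M l I r α S
  outer : α ∉ I
  rank : r α = 0
  work : ∀ W, S.work = some W → ∃ x ∈ S.verts, x ∉ I ∧ S.root x = W
  below : BelowBound K L I r S
  size : (S.verts.ncard : ℝ) ≤ K * L

theorem BelowBound.anti {r' : V → ℕ} {S : Struct V} (h : BelowBound K L I r S) (hK : 0 ≤ K)
    (hr : ∀ x ∈ S.verts, r' x ≤ r x) : BelowBound K L I r' S := by
  intro x hx hxI
  refine (h x hx hxI).trans ?_
  have : (r' x : ℝ) ≤ r x := Nat.cast_le.2 (hr x hx)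
  gcongr

namespace Struct.Good

variable {α : V} {S T P : Struct V}

theorem congr (hS : S.Good M K L l I r α) {l' : V × V → ℕ} {I' : Set V} {r' : V → ℕ}
    (hl : ∀ x ∈ S.verts, ∀ t, M.Adj x t → x ∈ I → l' (x, t) = l (x, t))
    (hI : ∀ x ∈ S.verts, (x ∈ I' ↔ x ∈ I)) (hr : ∀ x ∈ S.verts, r' x = r x) :
    S.Good M K L l' I' r' α where
  tree := hS.tree.congr (fun x hx hxI t ht => hl x hx t ht hxI) hI hr
  outer := (hI α hS.tree.mem).not.2 hS.outer
  rank := (hr α hS.tree.mem).trans hS.rank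
  work W hW := by
    obtain ⟨x, h1, h2, h3⟩ := hS.work W hW
    exact ⟨x, h1, (hI x h1).not.2 h2, h3⟩
  below x hx hxI := by
    rw [hr x hx]
    exact hS.below x hx ((hI x hx).1 hxI)
  size := hS.size

theorem set_work (hS : S.Good M K L l I r α) {w : Option (Set V)}
    (hw : ∀ W, w = some W → ∃ x ∈ S.verts, x ∉ I ∧ S.root x = W) :
    ({ S with work := w } : Struct V).Good M K L l I r α :=
  ⟨hS.tree.set_work w, hS.outer, hS.rank, hw, hS.below, hS.size⟩

theorem pruned [Finite V] (hT : T.Good M K L l I r α) (hM : M.IsMatching) {p v : V} (hvI : v ∈ I)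
    (hpv : (p, v) ∈ T.arcs) (hp : T.root p ≠ T.root v) {w : Option (Set V)}
    (hw : ∀ W, w = some W → ∃ x ∈ T.verts, x ∉ T.below v ∧ x ∉ I ∧ T.root x = W) :
    (T.pruned p v w).Good M K L l I r α where
  tree := hT.tree.pruned hM hvI hpv hp w
  outer := hT.outer
  rank := hT.rank
  work W hW := by
    obtain ⟨x, h1, h2, h3, h4⟩ := hw W hW
    exact ⟨x, ⟨h1, h2⟩, h3, (AltTree.root_pruned h2).trans h4⟩
  below := hT.tree.belowBound_mono (hT.tree.pruned hM hvI hpv hp w) Set.sdiff_subset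
    (Set.sdiff_subset.trans Set.sdiff_subset) Set.sdiff_subset hT.below
  size := le_trans (Nat.cast_le.2 (Set.ncard_le_ncard Set.sdiff_subset)) hT.size

theorem graft [Finite V] (hS : S.Good M K L l I r α) {u v : V} (hP : AltTree M l I r v P)
    (hvI : v ∈ I) (hd : Disjoint S.verts P.verts) (hu : u ∈ S.verts) (huI : u ∉ I)
    (huv : r u < r v) (hK : 0 ≤ K) (hbP : BelowBound K L I r P)
    (h1 : (S.verts.ncard : ℝ) + P.verts.ncard ≤ K * ((L : ℝ) + 1 - r u))
    (h2 : (S.verts.ncard : ℝ) + P.verts.ncard ≤ K * L) {w : Option (Set V)}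
    (hw : ∀ W, w = some W → ∃ x ∈ P.verts, x ∉ I ∧ P.root x = W) :
    (S.graft P u v w).Good M K L l I r α where
  tree := hS.tree.graft hP hvI hd hu huI huv w
  outer := hS.outer
  rank := hS.rank
  work W hW := by
    obtain ⟨x, h1, h2, h3⟩ := hw W hW
    exact ⟨x, .inr h1, h2, (hS.tree.root_graft_right hd h1).trans h3⟩
  below := hS.tree.belowBound_graft hP hd hu (hS.tree.graft hP hvI hd hu huI huv w) hK hS.below hbP
    h1
  size := by
    refine le_trans ?_ h2
    exact_mod_cast Set.ncard_union_le _ _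

open Classical in
theorem relabel_of_disjoint (hS : S.Good M K L l I r α) {v t : V} {k : ℕ}
    (hP : AltTree M l I r v P) (hd : Disjoint S.verts P.verts) :
    S.Good M K L (Function.update l (v, t) k) I
      (fun x => if x = v ∨ x ∈ P.root t then k else r x) α := by
  have hnot : ∀ x ∈ S.verts, ¬(x = v ∨ x ∈ P.root t) := by
    rintro x hx (rfl | h)
    · exact Set.disjoint_left.1 hd hx hP.mem
    · exact Set.disjoint_left.1 hd hx (hP.root_subset _ h)
  exact hS.congr (fun x hx z _ _ => Function.update_of_ne
    (fun h => hnot x hx (.inl (Prod.mk.inj h).1)) _ _) (fun x _ => Iff.rfl)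
    (fun x hx => if_neg (hnot x hx))

open Classical in
/-- Overtaking a matched arc that is already in a structure. -/
theorem graft_piece [Finite V] {β : V} (hS : S.Good M K L l I r α) (hT : T.Good M K L l I r β)
    (hM : M.IsMatching) {p u v t : V} {k : ℕ} (hvI : v ∈ I) (hvt : M.Adj v t)
    (hpv : (p, v) ∈ T.arcs) (hp : T.root p ≠ T.root v) (hd : Disjoint S.verts (T.below v))
    (hu : u ∈ S.verts) (huI : u ∉ I) (huk : r u < k) (hk : k ≤ r v) (hK : 0 ≤ K)
    (h1 : (S.verts.ncard : ℝ) + (T.below v).ncard ≤ K * ((L : ℝ) + 1 - r u))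
    (h2 : (S.verts.ncard : ℝ) + (T.below v).ncard ≤ K * L) {w : Option (Set V)}
    (hw : ∀ W, w = some W → ∃ x ∈ T.below v, x ∉ I ∧ T.root x = W) :
    (S.graft (T.piece v) u v w).Good M K L (Function.update l (v, t) k) I
      (fun x => if x = v ∨ x ∈ (T.piece v).root t then k else r x) α := by
  have hP := hT.tree.piece hM hvI hpv hp
  have hP' := hP.relabel hM hvI hvt hk
  have hvb : v ∈ T.below v := hP.mem
  have hnot : ∀ x ∈ S.verts, ¬(x = v ∨ x ∈ (T.piece v).root t) := by
    rintro x hx (rfl | h)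
    · exact Set.disjoint_left.1 hd hx hvb
    · exact Set.disjoint_left.1 hd hx (hP.root_subset _ h)
  have hS' := hS.relabel_of_disjoint (t := t) (k := k) hP hd
  -- The moved part satisfies the bounds for the old ranks; the new ranks are no larger, so the
  -- bounds persist.
  have hbP : BelowBound K L I r (T.piece v) := hT.tree.belowBound_mono hP (fun x hx => hx.1)
    (fun x hx => hx.1) (fun x hx => hx.1) hT.below
  refine hS'.graft hP' hvI hd hu huI ?_ hK (hbP.anti hK ?_) ?_ h2 ?_
  · simpa only [if_neg (hnot u hu), true_or, if_true] using huk
  · intro x hx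
    split_ifs with h
    · rcases h with rfl | h
      · exact hk
      · obtain ⟨htI, hvta, hne⟩ := hP.child_eq hM hP.mem hvI hvt
        rcases hP.cross v t hvta hne with h' | h'
        · exact absurd h'.2.1 htI
        · rw [hP.rank_root t x h, ← h'.2.2.2]
          exact hk
    · exact le_rfl
  · simp only [if_neg (hnot u hu)]
    exact h1
  · intro W hW
    obtain ⟨x, h3, h4, h5⟩ := hw W hW
    exact ⟨x, h3, h4, (hT.tree.root_piece h3).trans h5⟩

open Classical in
theorem contract [Finite V] (hS : S.Good M K L l I r α) {B : Blossom V} {k u v : V}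
    (hB : IsPetal M I r S B.verts k) (hu : u ∈ B.verts) (hv : v ∈ B.verts) :
    (S.contract u v B).Good M K L
      (fun a => if M.Adj a.1 a.2 ∧ a.1 ∈ B.verts ∧ a.2 ∈ B.verts then 0 else l a)
      (I \ B.verts) (fun x => if x ∈ B.verts then r k else r x) α where
  tree := hS.tree.contract hB hu hv
  outer h := hS.outer h.1
  rank := by
    split_ifs with h
    · rw [hS.tree.rank_congr (hB.subset hB.top_mem) (hS.tree.petal_root hB h), hS.rank]
    · exact hS.rank
  work W hW := by
    obtain rfl := Option.some.inj hW
    exact ⟨u, hB.subset hu, fun h => h.2 hu, AltTree.root_contract_of_mem hB hu⟩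
  below := hS.tree.belowBound_contract hB hu hv hS.below
  size := hS.size

end Struct.Good

/-- Overtaking within one structure amounts to cutting off the part below `v` and attaching it again
at `u`, so `Struct.Good.graft_piece` covers this case too. -/
theorem Struct.pruned_graft_piece {S : Struct V} {p u v : V} {w w' : Option (Set V)}
    (hp : p ∉ S.below v) : (S.pruned p v w').graft (S.piece v) u v w =
      { S with arcs := (S.arcs \ {(p, v)}) ∪ {(u, v)}, work := w } := by
  have h1 : S.verts \ S.below v ∪ S.below v = S.verts :=
    Set.sdiff_union_of_subset fun x hx => hx.1
  have h2 : S.blossoms \ S.blossomsIn (S.below v) ∪ S.blossomsIn (S.below v) = S.blossoms :=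
    Set.sdiff_union_of_subset fun x hx => hx.1
  have h3 : (S.arcs \ {(p, v)}) \ S.arcsIn (S.below v) ∪ {(u, v)} ∪ S.arcsIn (S.below v) =
      (S.arcs \ {(p, v)}) ∪ {(u, v)} := by
    rw [Set.union_right_comm, Set.sdiff_union_of_subset]
    rintro x hx
    refine ⟨hx.1, ?_⟩
    rintro rfl
    exact hp hx.2.1
  simp only [Struct.pruned, Struct.piece, Struct.graft, h1, h2, h3]

theorem Struct.root_of_trivial {S : Struct V}
    (h : ∀ B, B ∈ S.blossoms ↔ ∃ x ∈ S.verts, B = Blossom.trivial x) {x : V} (hx : x ∈ S.verts) :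
    S.root x = {x} := by
  ext y
  constructor
  · rintro ⟨B, hB, h1, h2⟩
    obtain ⟨z, hz, rfl⟩ := (h B).1 hB
    obtain rfl : x = z := h1
    exact h2
  · rintro rfl
    exact ⟨_, (h _).2 ⟨_, hx, rfl⟩, rfl, rfl⟩

/-- The structure of a single matched arc. -/
def Struct.ofArc (v t : V) : Struct V :=
  ⟨{v, t}, {(v, t)}, {Blossom.trivial v, Blossom.trivial t}, none⟩

theorem Struct.root_ofArc {v t x : V} (hx : x ∈ (Struct.ofArc v t).verts) :
    (Struct.ofArc v t).root x = {x} :=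
  Struct.root_of_trivial (fun B => by simp [Struct.ofArc]) hx

/-- Serves the two starting trees, a free vertex and an unvisited matched arc, in which no blossom
has been contracted. -/
theorem AltTree.of_trivial {ρ : V} {S : Struct V} (hρ : ρ ∈ S.verts)
    (h : ∀ B, B ∈ S.blossoms ↔ ∃ x ∈ S.verts, B = Blossom.trivial x)
    (harcs : ∀ x y, (x, y) ∈ S.arcs → x ∈ S.verts ∧ y ∈ S.verts)
    (hchild : ∀ x ∈ S.verts, x ∈ I → ∃ t, t ∉ I ∧ M.Adj x t ∧ (x, t) ∈ S.arcs)
    (hlabel : ∀ x ∈ S.verts, x ∈ I → ∀ t, M.Adj x t → l (x, t) = r x)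
    (hcross : ∀ x y, (x, y) ∈ S.arcs → x ≠ y →
      (x ∉ I ∧ y ∈ I ∧ r x < r y) ∨ (x ∈ I ∧ y ∉ I ∧ M.Adj x y ∧ r x = r y))
    (hmate : ∀ y ∈ S.verts, y ∉ I → ∀ z, M.Adj z y → z ∈ I ∧ z ∈ S.verts)
    (huniq : ∀ x y x', (x, y) ∈ S.arcs → (x', y) ∈ S.arcs → x = x')
    (hnp : ∀ x y, (x, y) ∈ S.arcs → y ≠ ρ)
    (hparent : ∀ x ∈ S.verts, x ≠ ρ → ∃ z, (z, x) ∈ S.arcs ∧ z ≠ x) :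
    AltTree M l I r ρ S := by
  have hr : ∀ x ∈ S.verts, S.root x = {x} := fun x hx => Struct.root_of_trivial h hx
  have hout : ∀ x y, y ∈ S.root x → y = x := by
    rintro x y ⟨B, hB, h1, h2⟩
    obtain ⟨z, hz, rfl⟩ := (h B).1 hB
    exact h2.trans h1.symm
  have hne : ∀ x y, (x, y) ∈ S.arcs → S.root x ≠ S.root y → x ≠ y := by
    rintro x y - h rfl
    exact h rfl
  refine ⟨hρ, ?_, ?_, ?_, harcs, fun x hx _ => hr x hx, ?_, hchild, hlabel,
    fun x y h1 h2 => hcross x y h1 (hne x y h1 h2), fun y hy hyI z hz => .inr (hmate y hy hyI z hz),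
    ?_, ?_, ?_⟩
  · intro B hB
    obtain ⟨z, hz, rfl⟩ := (h B).1 hB
    rintro x rfl
    exact hz
  · intro x hx
    exact ⟨Blossom.trivial x, (h _).2 ⟨x, hx, rfl⟩, rfl, (hr x hx).symm⟩
  · intro x y hy
    rw [hout x y hy]
  · intro x y hy
    rw [hout x y hy]
  · intro x y x' y' h1 h2 _ _ h3
    rw [hr y (harcs _ _ h1).2, hr y' (harcs _ _ h2).2, Set.singleton_eq_singleton_iff] at h3
    subst h3
    exact ⟨huniq x y x' h1 h2, rfl⟩
  · intro x y h1 _ h2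
    rw [hr y (harcs _ _ h1).2, hr ρ hρ, Set.singleton_eq_singleton_iff] at h2
    exact hnp x y h1 h2
  · intro x hx hxρ
    rw [hr x hx, hr ρ hρ, Ne, Set.singleton_eq_singleton_iff] at hxρ
    obtain ⟨z, h1, h2⟩ := hparent x hx hxρ
    refine ⟨z, x, h1, rfl, ?_⟩
    rw [hr z (harcs _ _ h1).1, hr x hx, Ne, Set.singleton_eq_singleton_iff]
    exact h2

theorem AltTree.ofArc (hM : M.IsMatching) {v t : V} (hvt : M.Adj v t) (hv : v ∈ I) (ht : t ∉ I)
    (hr : r t = r v) (hl : l (v, t) = r v) : AltTree M l I r v (Struct.ofArc v t) := by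
  have hvt' : v ≠ t := fun h => ht (h ▸ hv)
  have harc : ∀ x y, (x, y) ∈ (Struct.ofArc v t).arcs ↔ x = v ∧ y = t := by
    simp [Struct.ofArc]
  have hin : ∀ x ∈ (Struct.ofArc v t).verts, x ∈ I → x = v := by
    rintro x (rfl | rfl) h
    · rfl
    · exact absurd h ht
  refine AltTree.of_trivial (.inl rfl) (fun B => by simp [Struct.ofArc]) ?_ ?_ ?_ ?_ ?_ ?_ ?_ ?_
  · intro x y h
    obtain ⟨rfl, rfl⟩ := (harc x y).1 h
    exact ⟨.inl rfl, .inr rfl⟩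
  · intro x hx hxI
    obtain rfl := hin x hx hxI
    exact ⟨t, ht, hvt, rfl⟩
  · intro x hx hxI z hz
    obtain rfl := hin x hx hxI
    obtain rfl := hM.eq_of_adj_left hvt hz
    exact hl
  · intro x y h _
    obtain ⟨rfl, rfl⟩ := (harc x y).1 h
    exact .inr ⟨hv, ht, hvt, hr.symm⟩
  · rintro y (rfl | rfl) hyI z hz
    · exact absurd hv hyI
    · obtain rfl := hM.eq_of_adj_right hvt hz
      exact ⟨hv, .inl rfl⟩
  · intro x y x' h h'
    rw [((harc x y).1 h).1, ((harc x' y).1 h').1]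
  · intro x y h
    rw [((harc x y).1 h).2]
    exact hvt'.symm
  · rintro x (rfl | rfl) hx
    · exact absurd rfl hx
    · exact ⟨v, rfl, hvt'⟩

theorem AltTree.single {α : V} (hα : IsFree M α) : AltTree M l ∅ r α (Struct.single α) := by
  refine AltTree.of_trivial rfl (fun B => by simp [Struct.single]) ?_ ?_ ?_ ?_ ?_ ?_ ?_ ?_
  all_goals simp only [Struct.single, Set.mem_empty_iff_false, Set.mem_singleton_iff,
    IsEmpty.forall_iff, implies_true]
  · rintro y rfl - z hz
    exact absurd hz.symm (hα z)
  · exact fun x hx h => absurd hx h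

end Invariant


/-! ### Preservation of the invariant during a phase -/

section Phase

variable {V : Type*} {G : SimpleGraph V} {M : G.Subgraph} {I : Set V} {r : V → ℕ}
  {K : ℝ} {L : ℕ}

/-- The invariant of a phase. -/
structure State.Inv (M : G.Subgraph) (K : ℝ) (L : ℕ) (I : Set V) (r : V → ℕ)
    (s : State V) : Prop where
  good : ∀ α S, s.str α = some S → S.Good M K L s.label I r α
  disjoint : ∀ α β S T, α ≠ β → s.str α = some S → s.str β = some T → Disjoint S.verts T.verts
  label_le : ∀ a, s.label a ≤ L + 1
  active : ∀ α S, s.str α = some S → α ∉ s.onHold → α ∉ s.modified → (S.verts.ncard : ℝ) < K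

theorem update_some_eq_some {X Y : Type*} {_ : DecidableEq X} {f : X → Option Y} {a x : X} {b y : Y}
    (h : Function.update f a (some b) x = some y) : (x = a ∧ y = b) ∨ (x ≠ a ∧ f x = some y) := by
  by_cases hx : x = a
  · subst hx
    rw [Function.update_self] at h
    exact .inl ⟨rfl, (Option.some.inj h).symm⟩
  · rw [Function.update_of_ne hx] at h
    exact .inr ⟨hx, h⟩

theorem update_none_eq_some {X Y : Type*} {_ : DecidableEq X} {f : X → Option Y} {a x : X} {y : Y}
    (h : Function.update f a none x = some y) : x ≠ a ∧ f x = some y := by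
  by_cases hx : x = a
  · subst hx
    rw [Function.update_self] at h
    cases h
  · rw [Function.update_of_ne hx] at h
    exact ⟨hx, h⟩

theorem update_le {X : Type*} {_ : DecidableEq X} {f : X → ℕ} {a : X} {b n : ℕ}
    (hf : ∀ x, f x ≤ n) (hb : b ≤ n) (x : X) : Function.update f a b x ≤ n := by
  by_cases hx : x = a
  · subst hx
    rwa [Function.update_self]
  · rw [Function.update_of_ne hx]
    exact hf x

namespace State.Inv

variable {s s' : State V}

theorem augment (hs : s.Inv M K L I r) {α β u v : V} (h : Augment M s α β u v s') :
    s'.Inv M K L I r := by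
  obtain ⟨S, T, hS, hT, p, -, -, -, h⟩ := h
  have key : ∀ γ U, s'.str γ = some U → s.str γ = some U := by
    rw [h]
    intro γ U h
    dsimp only at h
    exact (update_none_eq_some (update_none_eq_some h).2).2
  subst h
  exact ⟨fun γ U h => hs.good γ U (key γ U h),
    fun γ δ U W hne h h' => hs.disjoint γ δ U W hne (key γ U h) (key δ W h'),
    hs.label_le, fun γ U h h1 h2 => hs.active γ U (key γ U h) h1 fun h3 => h2 (.inl h3)⟩

open Classical in
theorem contract [Finite V] (hs : s.Inv M K L I r) (hM : M.IsMatching) {α u v : V} {S : Struct V}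
    (hS : s.str α = some S) (huI : u ∉ I) (hvI : v ∉ I) (h : Contract M s α u v s') :
    ∃ I' r', s'.Inv M K L I' r' := by
  obtain ⟨S', hS', m, A, e, B, hB, hA, he, h⟩ := h
  obtain rfl := Option.some.inj (hS.symm.trans hS')
  have hg := hs.good α S hS
  obtain ⟨hu, hv, k, hk⟩ := hg.tree.exists_isPetal hM huI hvI hB hA he
  refine ⟨I \ B.verts, fun x => if x ∈ B.verts then r k else r x, ?_⟩
  have key : ∀ γ U, s'.str γ = some U → ∃ U', s.str γ = some U' ∧ U'.verts = U.verts := by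
    rw [h]
    intro γ U h
    dsimp only at h
    rcases update_some_eq_some h with ⟨rfl, rfl⟩ | ⟨-, h⟩
    · exact ⟨S, hS, rfl⟩
    · exact ⟨U, h, rfl⟩
  subst h
  refine ⟨?_, ?_, ?_, ?_⟩
  · intro γ U h
    dsimp only at h
    rcases update_some_eq_some h with ⟨rfl, rfl⟩ | ⟨hne, h1⟩
    · exact hg.contract hk hu hv
    · have hout : ∀ x ∈ U.verts, x ∉ B.verts := fun x hx hxB =>
        Set.disjoint_left.1 (hs.disjoint _ _ _ _ hne h1 hS) hx (hk.subset hxB)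
      refine (hs.good γ U h1).congr ?_ ?_ ?_
      · intro x hx t _ _
        exact if_neg fun h => hout x hx h.2.1
      · exact fun x hx => ⟨fun h => h.1, fun h => ⟨h, hout x hx⟩⟩
      · exact fun x hx => if_neg (hout x hx)
  · intro γ δ U W hne h h'
    obtain ⟨U', h1, h2⟩ := key γ U h
    obtain ⟨W', h1', h2'⟩ := key δ W h'
    rw [← h2, ← h2']
    exact hs.disjoint _ _ _ _ hne h1 h1'
  · intro a
    dsimp only
    split_ifs
    · exact Nat.zero_le _
    · exact hs.label_le a
  · intro γ U h h3 h4
    obtain ⟨U', h1, h2⟩ := key γ U h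
    rw [← h2]
    exact hs.active γ U' h1 h3 fun h5 => h4 (.inr h5)

theorem outer_of_work (hs : s.Inv M K L I r) {α u : V} {S : Struct V} (hS : s.str α = some S)
    (hu : u ∈ S.verts) (hw : S.work = some (S.root u)) : u ∉ I := by
  have hg := hs.good α S hS
  obtain ⟨x, hx, hxI, h⟩ := hg.work _ hw
  exact fun huI => hxI ((hg.tree.inner_congr hu hx h).2 huI)

/-- A matched arc entering an outer blossom from outside starts at its inner parent, whose label is
the rank handed down to the blossom. -/
theorem rank_eq_distance (hs : s.Inv M K L I r) (hM : M.IsMatching) {α u : V} {S : Struct V}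
    {d : ℕ} (hS : s.str α = some S) (hu : u ∈ S.verts) (huI : u ∉ I)
    (hd : IsDistance M s α S u d) : r u = d := by
  have hg := hs.good α S hS
  rcases hd with ⟨h, rfl⟩ | ⟨-, x, y, hxy, hx, hy, rfl⟩
  · rw [← hg.tree.rank_root u α h, hg.rank]
  · have hyV := hg.tree.root_subset u hy
    have hyu := hg.tree.root_eq u y hy
    have hyI : y ∉ I := fun h => huI ((hg.tree.inner_congr hu hyV hyu).1 h)
    rcases hg.tree.outer_mate y hyV hyI x hxy with h | ⟨hxI, hxV⟩
    · exact absurd (hyu ▸ h) hx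
    · obtain ⟨-, h2, h3⟩ := hg.tree.child_eq hM hxV hxI hxy
      rw [hg.tree.label_eq x hxV hxI y hxy, ← hg.tree.rank_root u y hy]
      rcases hg.tree.cross x y h2 h3 with h | h
      · exact absurd hxI h.1
      · exact h.2.2.2.symm

theorem inner_of_not_outerAt (hs : s.Inv M K L I r) {β v : V} {T : Struct V}
    (hT : s.str β = some T) (hv : v ∈ T.verts) (h : ¬ s.OuterAt v) : v ∈ I := by
  have hg := hs.good β T hT
  by_contra hvI
  exact h ⟨β, T, hT, hv, (hg.tree.isOuter_iff hg.outer hv).2 hvI⟩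

open Classical in
theorem overtake_unvisited [Finite V] (hs : s.Inv M K L I r) (hM : M.IsMatching) (hK : 2 ≤ K)
    (hL : 2 ≤ L) {α u v t : V} {S : Struct V} (hS : s.str α = some S) (hu : u ∈ S.verts)
    (huI : u ∉ I) (hvt : M.Adj v t) (hd : r u + 1 < s.label (v, t))
    (hsize : (S.verts.ncard : ℝ) < K) (hv : s.Unvisited v)
    (h : s' = { s with
        label := Function.update s.label (v, t) (r u + 1)
        str := Function.update s.str α (some
          { verts := S.verts ∪ {v, t}
            arcs := S.arcs ∪ {(u, v), (v, t)}
            blossoms := S.blossoms ∪ {Blossom.trivial v, Blossom.trivial t}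
            work := some {t} })
        modified := insert α s.modified }) :
    ∃ I' r', s'.Inv M K L I' r' := by
  have hgS := hs.good α S hS
  have htU : s.Unvisited t := fun β T hT ht =>
    hv β T hT ((hs.good β T hT).tree.mate_mem hM ht hvt.symm)
  have hvt' : v ≠ t := hvt.ne
  have hl := hs.label_le (v, t)
  -- The invariant does not restrict `I` and `r` on vertices in no structure, so `v` is put into
  -- `I`, `t` is taken out, and both get their ranks afresh.
  have hcongr : ∀ γ U, s.str γ = some U →
      U.Good M K L (Function.update s.label (v, t) (r u + 1)) (insert v I \ {t})
        (fun x => if x = v ∨ x = t then r u + 1 else r x) γ := by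
    intro γ U h
    have hxv : ∀ x ∈ U.verts, x ≠ v := fun x hx hc => hv γ U h (hc ▸ hx)
    have hxt : ∀ x ∈ U.verts, x ≠ t := fun x hx hc => htU γ U h (hc ▸ hx)
    refine (hs.good γ U h).congr ?_ ?_ ?_
    · exact fun x hx z _ _ => Function.update_of_ne (fun h => hxv x hx (Prod.mk.inj h).1) _ _
    · intro x hx
      simp [hxv x hx, hxt x hx]
    · exact fun x hx => if_neg (not_or.2 ⟨hxv x hx, hxt x hx⟩)
  have hdis : ∀ γ U, s.str γ = some U → Disjoint U.verts {v, t} := by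
    intro γ U hU
    rw [Set.disjoint_right]
    rintro x (rfl | rfl)
    · exact hv γ U hU
    · exact htU γ U hU
  have huv : u ≠ v := fun h => hv α S hS (h ▸ hu)
  have hut : u ≠ t := fun h => htU α S hS (h ▸ hu)
  -- The label is above `r u + 1` and at most `L + 1`. Thus `L + 1 - r u ≥ 2`, and the new size,
  -- less than `K + 2 ≤ 2 * K`, is small enough.
  have hru : (r u : ℝ) + 1 ≤ L := by exact_mod_cast (by omega : r u + 1 ≤ L)
  have hL' : (2 : ℝ) ≤ L := by exact_mod_cast hL
  have hcard : (((Struct.ofArc v t).verts.ncard : ℕ) : ℝ) = 2 := by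
    have : (Struct.ofArc v t).verts.ncard = 2 := Set.ncard_pair hvt'
    exact_mod_cast this
  have hnew : (S.graft (Struct.ofArc v t) u v (some {t})).Good M K L
      (Function.update s.label (v, t) (r u + 1)) (insert v I \ {t})
      (fun x => if x = v ∨ x = t then r u + 1 else r x) α := by
    refine (hcongr α S hS).graft ?_ ⟨.inl rfl, hvt'⟩ (hdis α S hS) hu ?_ ?_ (by linarith)
      ?_ ?_ ?_ ?_
    · exact AltTree.ofArc hM hvt ⟨.inl rfl, hvt'⟩ (fun h => h.2 rfl) (by simp) (by simp)
    · rintro ⟨h | h, -⟩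
      · exact huv h
      · exact huI h
    · simp [huv, hut]
    · rintro x (rfl | rfl) hxI
      · have h1 : (Struct.ofArc x t).below x ⊆ (Struct.ofArc x t).verts := fun y hy => hy.1
        refine le_trans (Nat.cast_le.2 (Set.ncard_le_ncard h1)) ?_
        simp only [true_or, if_true, hcard]
        push_cast
        nlinarith
      · exact absurd rfl hxI.2
    · simp only [huv, hut, or_self, if_false, hcard]
      nlinarith
    · rw [hcard]
      nlinarith
    · intro W hW
      obtain rfl := Option.some.inj hW
      exact ⟨t, .inr rfl, fun h => h.2 rfl, Struct.root_ofArc (.inr rfl)⟩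
  have hstr : S.graft (Struct.ofArc v t) u v (some {t}) =
      { verts := S.verts ∪ {v, t}
        arcs := S.arcs ∪ {(u, v), (v, t)}
        blossoms := S.blossoms ∪ {Blossom.trivial v, Blossom.trivial t}
        work := some {t} } := by
    simp only [Struct.graft, Struct.ofArc, Struct.mk.injEq, true_and, and_true]
    rw [Set.union_assoc, Set.singleton_union]
  rw [← hstr] at h
  have key : ∀ γ U, s'.str γ = some U →
      (γ = α ∧ U = S.graft (Struct.ofArc v t) u v (some {t})) ∨ (γ ≠ α ∧ s.str γ = some U) := by
    rw [h]
    intro γ U h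
    dsimp only at h
    exact update_some_eq_some h
  subst h
  refine ⟨insert v I \ {t}, fun x => if x = v ∨ x = t then r u + 1 else r x, ?_, ?_, ?_, ?_⟩
  · intro γ U h
    rcases key γ U h with ⟨rfl, rfl⟩ | ⟨-, h⟩
    · exact hnew
    · exact hcongr γ U h
  · intro γ δ U W hne h h'
    rcases key γ U h with ⟨rfl, rfl⟩ | ⟨h1, h2⟩ <;> rcases key δ W h' with ⟨rfl, rfl⟩ | ⟨h3, h4⟩
    · exact absurd rfl hne
    · exact Set.disjoint_union_left.2 ⟨hs.disjoint _ _ _ _ hne hS h4, (hdis δ W h4).symm⟩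
    · exact Set.disjoint_union_right.2 ⟨hs.disjoint _ _ _ _ hne h2 hS, hdis γ U h2⟩
    · exact hs.disjoint _ _ _ _ hne h2 h4
  · exact update_le hs.label_le (by omega)
  · intro γ U h h3 h4
    rcases key γ U h with ⟨rfl, rfl⟩ | ⟨h1, h2⟩
    · exact absurd (.inl rfl) h4
    · exact hs.active γ U h2 h3 fun h5 => h4 (.inr h5)

open Classical in
theorem overtake_same [Finite V] (hs : s.Inv M K L I r) (hM : M.IsMatching) (hK : 0 ≤ K)
    {α u v t p : V} {S : Struct V} (hS : s.str α = some S) (hu : u ∈ S.verts)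
    (huI : u ∉ I) (hvt : M.Adj v t) (hd : r u + 1 < s.label (v, t))
    (hsize : (S.verts.ncard : ℝ) < K) (hv : v ∈ S.verts) (hvI : v ∈ I) (hpv : (p, v) ∈ S.arcs)
    (hp : S.root p ≠ S.root v)
    (h : s' = { s with
        label := Function.update s.label (v, t) (r u + 1)
        str := Function.update s.str α (some
          { S with
            arcs := (S.arcs \ {(p, v)}) ∪ {(u, v)}
            work := some (S.root t) })
        modified := insert α s.modified }) :
    ∃ I' r', s'.Inv M K L I' r' := by
  have hg := hs.good α S hS
  have hl := hs.label_le (v, t)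
  rw [hg.tree.label_eq v hv hvI t hvt] at hd hl
  have hP := hg.tree.piece hM hvI hpv hp
  -- Otherwise the new arc would close a cycle; but below `v` ranks are at least `r v > r u + 1`.
  have huX : u ∉ S.below v := fun h => by
    have := hg.tree.rank_le_of_mem_below hv hvI h
    omega
  obtain ⟨htI, hvta, hvtne⟩ := hg.tree.child_eq hM hv hvI hvt
  have htX : t ∈ S.below v := hg.tree.below_arc hP.mem hvta
  have hru : (r u : ℝ) + 1 ≤ L := by exact_mod_cast (by omega : r u + 1 ≤ L)
  have hsum : ((S.pruned p v none).verts.ncard : ℝ) + (S.below v).ncard = S.verts.ncard := by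
    exact_mod_cast Set.ncard_sdiff_add_ncard_of_subset (s := S.below v) fun x hx => hx.1
  have hnew : ((S.pruned p v none).graft (S.piece v) u v (some (S.root t))).Good M K L
      (Function.update s.label (v, t) (r u + 1)) I
      (fun x => if x = v ∨ x ∈ (S.piece v).root t then r u + 1 else r x) α := by
    refine (hg.pruned hM hvI hpv hp (w := none) fun W hW => by cases hW).graft_piece hg hM hvI hvt
      hpv hp Set.disjoint_sdiff_left ⟨hu, huX⟩ huI (Nat.lt_succ_self _) (by omega) hK ?_ ?_ ?_
    · rw [hsum]
      nlinarith
    · rw [hsum]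
      have : (0 : ℝ) ≤ r u := Nat.cast_nonneg _
      nlinarith
    · intro W hW
      exact ⟨t, htX, htI, Option.some.inj hW⟩
  rw [Struct.pruned_graft_piece (hg.tree.parent_notMem_below hpv hp)] at hnew
  have key : ∀ γ U, s'.str γ = some U →
      (γ = α ∧ U = { S with arcs := (S.arcs \ {(p, v)}) ∪ {(u, v)}, work := some (S.root t) }) ∨
      (γ ≠ α ∧ s.str γ = some U) := by
    rw [h]
    intro γ U h
    dsimp only at h
    exact update_some_eq_some h
  subst h
  refine ⟨I, fun x => if x = v ∨ x ∈ (S.piece v).root t then r u + 1 else r x, ?_, ?_, ?_, ?_⟩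
  · intro γ U h
    rcases key γ U h with ⟨rfl, rfl⟩ | ⟨h1, h2⟩
    · exact hnew
    · exact (hs.good γ U h2).relabel_of_disjoint hP
        ((hs.disjoint _ _ _ _ h1 h2 hS).mono_right fun x hx => hx.1)
  · intro γ δ U W hne h h'
    rcases key γ U h with ⟨rfl, rfl⟩ | ⟨h1, h2⟩ <;> rcases key δ W h' with ⟨rfl, rfl⟩ | ⟨h3, h4⟩
    · exact absurd rfl hne
    · exact hs.disjoint _ _ S W hne hS h4
    · exact hs.disjoint _ _ U S hne h2 hS
    · exact hs.disjoint _ _ _ _ hne h2 h4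
  · exact update_le hs.label_le (by omega)
  · intro γ U h h3 h4
    rcases key γ U h with ⟨rfl, rfl⟩ | ⟨h1, h2⟩
    · exact absurd (.inl rfl) h4
    · exact hs.active γ U h2 h3 fun h5 => h4 (.inr h5)

open Classical in
theorem overtake_other [Finite V] (hs : s.Inv M K L I r) (hM : M.IsMatching) (hK : 0 ≤ K)
    {α β u v t p : V} {S T : Struct V} (hS : s.str α = some S) (hu : u ∈ S.verts)
    (huI : u ∉ I) (hvt : M.Adj v t) (hd : r u + 1 < s.label (v, t))
    (hsize : (S.verts.ncard : ℝ) < K) (hαβ : α ≠ β) (hT : s.str β = some T) (hv : v ∈ T.verts)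
    (hvI : v ∈ I) (hpv : (p, v) ∈ T.arcs) (hp : T.root p ≠ T.root v)
    (h : s' = { s with
        label := Function.update s.label (v, t) (r u + 1)
        str := Function.update (Function.update s.str α (some
          (S.graft (T.piece v) u v (if T.WorkBelow t then T.work else some (T.root t))))) β (some
          (T.pruned p v (if T.WorkBelow t then some (T.root p) else T.work)))
        modified := s.modified ∪ {α, β} }) :
    ∃ I' r', s'.Inv M K L I' r' := by
  have hgS := hs.good α S hS
  have hgT := hs.good β T hT
  have hdST := hs.disjoint α β S T hαβ hS hT
  have hl := hs.label_le (v, t)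
  rw [hgT.tree.label_eq v hv hvI t hvt] at hd hl
  have hP := hgT.tree.piece hM hvI hpv hp
  have hXT : T.below v ⊆ T.verts := fun x hx => hx.1
  obtain ⟨htI, hvta, hvtne⟩ := hgT.tree.child_eq hM hv hvI hvt
  obtain ⟨hpV, -⟩ := hgT.tree.arcs_sub _ _ hpv
  have htX : t ∈ T.below v := hgT.tree.below_arc hP.mem hvta
  have hpI : p ∉ I := by
    rcases hgT.tree.cross p v hpv hp with h | h
    · exact h.1
    · exact absurd hvI h.2.1
  -- The strict inequality in the test is worth two ranks: one pays for the fewer than `K` vertices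
  -- of `S`, the other makes up for the `+ 1` in the bound below `v`.
  have hru : (r u : ℝ) + 2 ≤ r v := by exact_mod_cast (by omega : r u + 2 ≤ r v)
  have hru0 : (0 : ℝ) ≤ r u := Nat.cast_nonneg _
  have hX := hgT.below v hv hvI
  -- The only child of `v` is the blossom of its mate `t`, so for an outer working vertex being
  -- below `v` and below `t` is the same. Hence it moves exactly when its vertices do.
  have hwork : ∀ W, T.work = some W → ∃ x ∈ T.verts, x ∉ I ∧ T.root x = W ∧
      (T.WorkBelow t ↔ x ∈ T.below v) := by
    intro W hW
    obtain ⟨x, hx, hxI, rfl⟩ := hgT.work W hW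
    refine ⟨x, hx, hxI, rfl, ?_, ?_⟩
    · rintro ⟨W, hW', hsub⟩
      obtain rfl := Option.some.inj (hW.symm.trans hW')
      exact ⟨hx, Relation.ReflTransGen.head ⟨hvtne, v, t, hvta, rfl, rfl⟩ hsub⟩
    · rintro ⟨-, hsub⟩
      refine ⟨_, hW, ?_⟩
      rcases Relation.ReflTransGen.cases_head hsub with h | ⟨A, ⟨hne, y, z, hyz, hy, rfl⟩, hA⟩
      · exact absurd h (hgT.tree.root_ne_of_inner_outer hv hx hvI hxI)
      · obtain ⟨hyV, -⟩ := hgT.tree.arcs_sub _ _ hyz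
        obtain rfl := hgT.tree.eq_of_inner hv hyV hvI hy
        rcases hgT.tree.cross _ z hyz hne with h | h
        · exact absurd hvI h.1
        · rwa [hM.eq_of_adj_left hvt h.2.2.1]
  have hnewS : (S.graft (T.piece v) u v (if T.WorkBelow t then T.work else some (T.root t))).Good
      M K L (Function.update s.label (v, t) (r u + 1)) I
      (fun x => if x = v ∨ x ∈ (T.piece v).root t then r u + 1 else r x) α := by
    refine hgS.graft_piece hgT hM hvI hvt hpv hp (hdST.mono_right hXT) hu huI (Nat.lt_succ_self _)
      (by omega) hK ?_ ?_ ?_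
    -- The union has fewer than `K + K * (L + 1 - r v) ≤ K * (L - r u)` vertices, which suffices for
    -- both size conditions.
    · nlinarith
    · nlinarith
    · intro W hW
      split_ifs at hW with hc
      · obtain ⟨x, hx, hxI, hxW, hiff⟩ := hwork W hW
        exact ⟨x, hiff.1 hc, hxI, hxW⟩
      · exact ⟨t, htX, htI, Option.some.inj hW⟩
  have hnewT : (T.pruned p v (if T.WorkBelow t then some (T.root p) else T.work)).Good
      M K L (Function.update s.label (v, t) (r u + 1)) I
      (fun x => if x = v ∨ x ∈ (T.piece v).root t then r u + 1 else r x) β := by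
    refine (hgT.pruned hM hvI hpv hp ?_).relabel_of_disjoint hP Set.disjoint_sdiff_left
    intro W hW
    split_ifs at hW with hc
    · exact ⟨p, hpV, hgT.tree.parent_notMem_below hpv hp, hpI, Option.some.inj hW⟩
    · obtain ⟨x, hx, hxI, hxW, hiff⟩ := hwork W hW
      exact ⟨x, hx, fun h => hc (hiff.2 h), hxI, hxW⟩
  have key : ∀ γ U, s'.str γ = some U →
      (γ = β ∧ U = T.pruned p v (if T.WorkBelow t then some (T.root p) else T.work)) ∨
      (γ = α ∧ U = S.graft (T.piece v) u v (if T.WorkBelow t then T.work else some (T.root t))) ∨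
      (γ ≠ β ∧ γ ≠ α ∧ s.str γ = some U) := by
    rw [h]
    intro γ U h
    dsimp only at h
    rcases update_some_eq_some h with h | ⟨h1, h2⟩
    · exact .inl h
    · rcases update_some_eq_some h2 with h | ⟨h3, h4⟩
      · exact .inr (.inl h)
      · exact .inr (.inr ⟨h1, h3, h4⟩)
  subst h
  refine ⟨I, fun x => if x = v ∨ x ∈ (T.piece v).root t then r u + 1 else r x, ?_, ?_, ?_, ?_⟩
  · intro γ U h
    rcases key γ U h with ⟨rfl, rfl⟩ | ⟨rfl, rfl⟩ | ⟨h1, h2, h3⟩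
    · exact hnewT
    · exact hnewS
    · exact (hs.good γ U h3).relabel_of_disjoint hP
        ((hs.disjoint _ _ _ _ h1 h3 hT).mono_right hXT)
  · have hST : Disjoint (S.verts ∪ T.below v) (T.verts \ T.below v) :=
      Set.disjoint_union_left.2 ⟨hdST.mono_right Set.sdiff_subset, Set.disjoint_sdiff_right⟩
    have hU : ∀ γ U, γ ≠ β → γ ≠ α → s.str γ = some U → Disjoint U.verts (S.verts ∪ T.below v) :=
      fun γ U h1 h2 h3 => Set.disjoint_union_right.2 ⟨hs.disjoint _ _ _ _ h2 h3 hS,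
        (hs.disjoint _ _ _ _ h1 h3 hT).mono_right hXT⟩
    have hU' : ∀ γ U, γ ≠ β → s.str γ = some U → Disjoint U.verts (T.verts \ T.below v) :=
      fun γ U h1 h2 => (hs.disjoint _ _ _ _ h1 h2 hT).mono_right Set.sdiff_subset
    intro γ δ U W hne h h'
    rcases key γ U h with ⟨rfl, rfl⟩ | ⟨rfl, rfl⟩ | ⟨h1, h2, h3⟩ <;>
      rcases key δ W h' with ⟨rfl, rfl⟩ | ⟨rfl, rfl⟩ | ⟨h1', h2', h3'⟩
    · exact absurd rfl hne
    · exact hST.symm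
    · exact (hU' _ _ h1' h3').symm
    · exact hST
    · exact absurd rfl hne
    · exact (hU _ _ h1' h2' h3').symm
    · exact hU' _ _ h1 h3
    · exact hU _ _ h1 h2 h3
    · exact hs.disjoint _ _ _ _ hne h3 h3'
  · exact update_le hs.label_le (by omega)
  · intro γ U h h3 h4
    rcases key γ U h with ⟨rfl, rfl⟩ | ⟨rfl, rfl⟩ | ⟨-, -, h2⟩
    · exact absurd (.inr (.inr rfl)) h4
    · exact absurd (.inr (.inl rfl)) h4
    · exact hs.active γ U h2 h3 fun h5 => h4 (.inl h5)

theorem extendArc [Finite V] (hs : s.Inv M K L I r) (hM : M.IsMatching) (hK : 2 ≤ K)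
    (hL : 2 ≤ L) {u v : V} (h : ExtendArc M s u v s') : ∃ I' r', s'.Inv M K L I' r' := by
  cases h with
  | @contract α S _ he hv ho hc =>
    have hg := hs.good α S he.str
    exact hs.contract hM he.str (hs.outer_of_work he.str he.mem he.work)
      ((hg.tree.isOuter_iff hg.outer hv).1 ho) hc
  | augment _ _ _ _ _ ha => exact ⟨I, r, hs.augment ha⟩
  | skip _ _ => exact ⟨I, r, hs⟩
  | @overtake α t S d _ ht ho =>
    obtain ⟨he, hno, hvt, hd, hlt⟩ := ht
    have huI := hs.outer_of_work he.str he.mem he.work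
    obtain rfl := hs.rank_eq_distance hM he.str he.mem huI hd
    have hsize := hs.active α S he.str he.not_onHold he.not_modified
    have hK0 : 0 ≤ K := by linarith
    cases ho with
    | unvisited hS hv =>
      obtain rfl := Option.some.inj (he.str.symm.trans hS)
      exact hs.overtake_unvisited hM hK hL hS he.mem huI hvt hlt hsize hv rfl
    | same hS hv hpv hp =>
      obtain rfl := Option.some.inj (he.str.symm.trans hS)
      exact hs.overtake_same hM hK0 hS he.mem huI hvt hlt hsize hv
        (hs.inner_of_not_outerAt hS hv hno) hpv hp rfl
    | other hS hαβ hT hv hpv hp =>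
      obtain rfl := Option.some.inj (he.str.symm.trans hS)
      exact hs.overtake_other hM hK0 hS he.mem huI hvt hlt hsize hαβ hT hv
        (hs.inner_of_not_outerAt hT hv hno) hpv hp rfl

theorem backtrack (hs : s.Inv M K L I r) (h : Backtrack s s') : s'.Inv M K L I r := by
  obtain ⟨str', rfl, hstr⟩ := h
  have key : ∀ γ U, str' γ = some U → ∃ U', s.str γ = some U' ∧ U'.verts = U.verts ∧
      U.Good M K L s.label I r γ := by
    intro γ U h
    obtain ⟨h1, h2⟩ := hstr γ
    cases hγ : s.str γ with
    | none => rw [h1 hγ] at h; cases h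
    | some S =>
      have hg := hs.good γ S hγ
      obtain ⟨h3, h4⟩ := h2 S hγ
      by_cases hc : γ ∈ s.onHold ∨ γ ∈ s.modified
      · obtain rfl := Option.some.inj ((h3 hc).symm.trans h)
        exact ⟨S, rfl, rfl, hg⟩
      · obtain ⟨S', h5, h6⟩ := h4 (not_or.1 hc)
        obtain rfl := Option.some.inj (h6.symm.trans h)
        cases h5 with
        | inactive _ => exact ⟨S, rfl, rfl, hg⟩
        | root _ => exact ⟨S, rfl, rfl, hg.set_work fun W hW => by cases hW⟩
        | @nonroot A B C hC _ hBC hAB =>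
          refine ⟨S, rfl, rfl, hg.set_work fun W hW => ?_⟩
          obtain rfl := Option.some.inj hW
          obtain ⟨x, hx, hxI, rfl⟩ := hg.work _ hC
          obtain ⟨hne, y, z, hyz, rfl, hz⟩ := hBC
          obtain ⟨hne', y', z', hyz', rfl, hz'⟩ := hAB
          obtain ⟨hyV, hzV⟩ := hg.tree.arcs_sub _ _ hyz
          obtain ⟨hyV', hzV'⟩ := hg.tree.arcs_sub _ _ hyz'
          have hzI : z ∉ I := fun h => hxI ((hg.tree.inner_congr hx hzV hz).1 h)
          have hyI : y ∈ I := by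
            rcases hg.tree.cross y z hyz (hz ▸ hne) with h | h
            · exact absurd h.2.1 hzI
            · exact h.1
          -- The parent of an outer blossom is an inner vertex and a trivial root blossom, so the
          -- two tree arcs meet in one vertex and the grandparent is outer again.
          obtain rfl := hg.tree.eq_of_inner hyV hzV' hyI hz'
          rcases hg.tree.cross y' _ hyz' hne' with h | h
          · exact ⟨y', hyV', h.1, rfl⟩
          · exact absurd hyI h.2.1
  refine ⟨fun γ U h => (key γ U h).choose_spec.2.2, ?_, hs.label_le, ?_⟩
  · intro γ δ U W hne h h'
    obtain ⟨U', h1, h2, -⟩ := key γ U h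
    obtain ⟨W', h1', h2', -⟩ := key δ W h'
    rw [← h2, ← h2']
    exact hs.disjoint _ _ _ _ hne h1 h1'
  · intro γ U h h3 h4
    obtain ⟨U', h1, h2, -⟩ := key γ U h
    rw [← h2]
    exact hs.active γ U' h1 h3 h4

end State.Inv

/-- Clearing the modified marks is safe because the marks for holding are recomputed at the same
time: whatever is not on hold is below the limit. -/
theorem State.Inv.mark {s : State V} {h : ℝ} (hs : s.Inv M (limit h) L I r) :
    (AlgPhase.mark h s).Inv M (limit h) L I r :=
  ⟨hs.good, hs.disjoint, hs.label_le, fun _ S hS hn _ => not_le.1 fun hle => hn ⟨S, hS, hle⟩⟩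

theorem State.Inv.init [Finite V] (ε : ℝ) (hK : 1 < K) (hL : 1 ≤ ellMax ε) :
    (initState M ε).Inv M K (ellMax ε) ∅ fun _ => 0 := by
  classical
  have key : ∀ γ U, (initState M ε).str γ = some U → IsFree M γ ∧ U = Struct.single γ := by
    intro γ U h
    simp only [initState] at h
    split_ifs at h with hf
    · exact ⟨hf, (Option.some.inj h).symm⟩
  have hL' : (1 : ℝ) ≤ ellMax ε := by exact_mod_cast hL
  refine ⟨?_, ?_, fun _ => le_rfl, ?_⟩
  · intro γ U h
    obtain ⟨hf, rfl⟩ := key γ U h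
    refine ⟨AltTree.single hf, Set.notMem_empty γ, rfl, ?_,
      fun x _ h => absurd h (Set.notMem_empty x), ?_⟩
    · intro W hW
      obtain rfl := Option.some.inj hW
      exact ⟨γ, rfl, Set.notMem_empty γ,
        Struct.root_of_trivial (fun B => by simp [Struct.single]) rfl⟩
    · simp only [Struct.single, Set.ncard_singleton, Nat.cast_one]
      nlinarith
  · intro γ δ U W hne h h'
    obtain ⟨-, rfl⟩ := key γ U h
    obtain ⟨-, rfl⟩ := key δ W h'
    exact Set.disjoint_singleton.2 hne
  · intro γ U h _ _
    obtain ⟨-, rfl⟩ := key γ U h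
    simpa [Struct.single] using hK

theorem State.Inv.step [Finite V] {ε h : ℝ} {c c' : Point V} {s s' : State V}
    (hs : s.Inv M (limit h) L I r) (hM : M.IsMatching) (hK : 2 ≤ limit h) (hL : 2 ≤ L)
    (hstep : Step M ε h (c, s) (c', s')) : ∃ I' r', s'.Inv M (limit h) L I' r' := by
  cases hstep with
  | start _ _ => exact ⟨I, r, hs.mark⟩
  | extend he => exact hs.extendArc hM hK hL he
  | extended => exact ⟨I, r, hs⟩
  | contract ht hc =>
    obtain ⟨-, S, hS, hu, hv, hw, -, ho⟩ := ht
    have hg := hs.good _ S hS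
    exact hs.contract hM hS (hs.outer_of_work hS hu hw)
      ((hg.tree.isOuter_iff hg.outer hv).1 ho) hc
  | contracted _ _ => exact ⟨I, r, hs⟩
  | augment ha =>
    cases ha with
    | augment _ ha => exact ⟨I, r, hs.augment ha⟩
    | skip _ => exact ⟨I, r, hs⟩
  | backtrack hb => exact ⟨I, r, hs.backtrack hb⟩

theorem State.Inv.of_occurs [Finite V] {ε h : ℝ} (hM : M.IsMatching) (hK : 2 ≤ limit h)
    (hL : 2 ≤ ellMax ε) {c : Point V} {s : State V} (hs : Occurs M ε h c s) :
    ∃ I r, s.Inv M (limit h) (ellMax ε) I r := by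
  have key : ∀ p : Point V × State V,
      Relation.ReflTransGen (Step M ε h) (.bundle 0, initState M ε) p →
      ∃ I r, p.2.Inv M (limit h) (ellMax ε) I r := by
    intro p hp
    induction hp with
    | refl => exact ⟨_, _, State.Inv.init ε (by linarith) (by omega)⟩
    | @tail p q _ hstep ih =>
      obtain ⟨I, r, hI⟩ := ih
      obtain ⟨c, s⟩ := p
      obtain ⟨c', s'⟩ := q
      exact hI.step hM hK hL hstep
  exact key _ hs

end Phase

end AlgPhase

theorem mainTheorem5 {V : Type*} [Finite V] (G : SimpleGraph V) (M : G.Subgraph)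
    (hM : M.IsMatching) (ε h : ℝ) (hε : ∃ j : ℕ, ε = (1 / 2) ^ j) (hh : AlgPhase.IsScale ε h)
    (c : AlgPhase.Point V) (s : AlgPhase.State V) (hs : AlgPhase.Occurs M ε h c s)
    (α : V) (S : AlgPhase.Struct V) (hS : s.str α = some S) :
    (S.verts.ncard : ℝ) ≤ AlgPhase.limit h * (AlgPhase.ellMax ε : ℝ) := by
  obtain ⟨j, rfl⟩ := hε
  obtain ⟨i, -, rfl, -⟩ := hh
  -- Of the parameters only `h ≤ 1` and `ε ≤ 1` matter; they leave room for the two vertices of an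
  -- unvisited arc.
  have hK : 2 ≤ AlgPhase.limit ((1 / 2) ^ i) := by
    have h1 : ((1 : ℝ) / 2) ^ i ≤ 1 := pow_le_one₀ (by norm_num) (by norm_num)
    have h2 : (6 : ℝ) ≤ 6 / (1 / 2) ^ i := by
      rw [le_div_iff₀ (by positivity)]
      linarith
    unfold AlgPhase.limit
    linarith
  have hL : 2 ≤ AlgPhase.ellMax ((1 / 2) ^ j) := by
    have h1 : ((1 : ℝ) / 2) ^ j ≤ 1 := pow_le_one₀ (by norm_num) (by norm_num)
    refine Nat.le_floor ?_
    rw [le_div_iff₀ (by positivity)]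
    push_cast
    linarith
  obtain ⟨I, r, hI⟩ := AlgPhase.State.Inv.of_occurs hM hK hL hs
  exact (hI.good α S hS).size
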